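/- Let $d\ge 2$, let $\mu=(\mu_1,\dots,\mu_\ell)$ be an ordered partition of $d$ and put $b=\ell+d-2$. *Galaxies.* A Hurwitz galaxy $G$ of type $(0,\mu,(1^d))$ is a graph on the sphere whose faces are open disks, coloured black and white so that every edge separates a white face from a black one, with $\ell$ labelled white faces of boundary lengths $\mu_i(b+1)$ and $d$ labelled black faces of boundary length $b+1$. Its vertices are coloured cyclically $0,1,\dots,b$ clockwise around the white faces, with $d$ vertices of colour $0$, all 2-valent, and, for every colour $i\in\{1,\dots,b\}$, $d-1$ vertices of colour $i$, one 4-valent and the others 2-valent. Edges are oriented $x\to y$ with $c(y)\equiv c(x)+1$ mod $b+1$. $G$ is *pruned* if no black face is a bubble, i.e. no black face has exactly one 4-valent vertex on its boundary. Mark a vertex $x_0$ of colour $0$, let $\delta(x)$ be the length of a shortest oriented path from $x_0$ to $x$, and let an edge $e=x\to y$ have weight $w(e)=(\delta(x)+1-\delta(y))/(b+1)$; $e$ is geodesic if $w(e)=0$. *Mobiles.* A single Hurwitz mobile of type $\mu$ is a connected graph consisting of $\ell$ labelled oriented white polygons with $\mu_1,\dots,\mu_\ell$ nodes, $d$ labelled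 oriented black polygons with one node each, and $b+1$ non-oriented edges with distinct labels in $\{0,\dots,b\}$ and non-negative integer weights, such that weight-$0$ edges join two nodes on white polygons, edges of positive weight join a white polygon to a black one, and the weights of the edges incident to any $i$-gon sum to $i$. The mobile $\Phi(G,x_0)$ is constructed as follows. In each face of degree $i$ (boundary length $i(b+1)$) place an $i$-gon, oriented clockwise in white and counter-clockwise in black faces, and join its $i$ nodes to the midpoints of the $i$ edges $b\to 0$ of the face. This cuts the part of the face outside the $i$-gon into $i$ regions, each incident to one arc of the polygon and to one boundary path $0\to1\to\dots\to b$. For each non-geodesic edge $u\to v$ take a mobile edge of label $c(v)$ and weight $w(u\to v)$ between the origins of the arcs incident to the regions of the adjacent white and black face which contain $v$ (next to that edge); for each vertex $v$ with two incoming geodesic edges take a mobile edge of label $c(v)$ and weight $0$ between the origins of the two arcs whose white regions are incident to $v$. A mobile $M$ is in *standard form* if $M\cong\Phi(G,x_0)$ for some marked galaxy $(G,x_0)$, to which it is then said to correspond. *Distances.* Draw the mobile in the plane with white polygons oriented clockwise, black polygons counter-clockwise, all edges outside the polygons, and the edges at a node $s$ placed between $s$ and the next node, by increasing label in the direction of the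 orientation. For a black polygon $P$ with incident weight-$1$ edge $y$ and an edge $z\ne y$, let $d_\circ(y,z)$ and $d_\bullet(y,z)$ be the numbers of white and of black arcs traversed by the counter-clockwise path around the mobile (which has the polygons on its left) that starts at $y$, traverses the black arc of $P$ and continues until it first reaches $z$. The edge $y$ is *interrupted* by $z$ if $d_\circ(y,z)<d_\bullet(y,z)$, or if $d_\circ(y,z)=d_\bullet(y,z)$ and the label of $y$ is less than the label of $z$. The *next edge* after $y$ is the first edge other than $y$ reached by this path. **Theorem.** Let $M$ be a single Hurwitz mobile of type $\mu$ in standard form, corresponding to the marked galaxy $(G,x_0)$. Then $G$ is pruned if and only if every black polygon $P$ of $M$ satisfies one of the following two conditions: 1. the weight-$1$ edge $y$ incident to $P$ has label $\neq 0$ and is interrupted by the next edge after $y$; 2. the weight-$1$ edge incident to $P$ has label $0$, and the next edge after it is either (a) an edge of weight $0$, or (b) a weight-$1$ edge $y$ such that some edge $z\neq y$ of $M$ with label $\neq 0$ does not interrupt $y$. -/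

import Mathlib

open Equiv

universe u v

/-- The number `b = 2g - 2 + ℓ(μ) + ℓ(ν)` of simple branch points. -/
def branchNumber (g : ℕ) {d : ℕ} (μ ν : Composition d) : ℕ :=
  2 * g + μ.length + ν.length - 2

/-! ### Galaxies

A graph on an oriented surface whose faces are open disks, coloured black and white so that every
edge separates a black face from a white one, is encoded by its set of edges and two permutations.
Every edge is oriented so that its white face is on its right and its black face on its left;
`white e` is the edge after `e` on the (clockwise) boundary of the white face of `e`, and `black e`
is the edge after `e` on the (counter-clockwise) boundary of the black face of `e`.
Around a vertex incoming and outgoing edges alternate: next to the incoming edge `e` comes the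
outgoing edge `white e`, and next to it the incoming edge `black⁻¹ (white e)`.
So white faces, black faces and vertices are the cycles of `white`, `black`, `black⁻¹ * white`
(the last one acting on the edges as incoming edges). -/

/-- A graph with bicoloured faces on an oriented surface. -/
structure BicolouredMap where
  Edge : Type v
  white : Perm Edge
  black : Perm Edge

namespace BicolouredMap

variable (G : BicolouredMap.{v})

/-- The vertices. -/
def Vertex : Type v := Quotient (Perm.SameCycle.setoid (G.black⁻¹ * G.white))

/-- The endpoint of an oriented edge. -/
def target (e : G.Edge) : G.Vertex := Quotient.mk _ e

/-- The starting point of an oriented edge. -/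
def source (e : G.Edge) : G.Vertex := G.target (G.white⁻¹ e)

theorem source_white (e : G.Edge) : G.source (G.white e) = G.target e := by
  simp [source]

theorem source_black (e : G.Edge) : G.source (G.black e) = G.target e := by
  refine Quotient.sound ⟨1, ?_⟩
  simp

/-- The number of edge ends at a vertex; there are as many outgoing ends as incoming ones. -/
noncomputable def valency (x : G.Vertex) : ℕ := 2 * Nat.card {e : G.Edge // G.target e = x}

/-- There is an oriented path with `n` edges between two vertices. -/
inductive OrientedPath : ℕ → G.Vertex → G.Vertex → Prop
  | nil (x : G.Vertex) : OrientedPath 0 x x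
  | snoc {n : ℕ} {x : G.Vertex} (e : G.Edge) :
      OrientedPath n x (G.source e) → OrientedPath (n + 1) x (G.target e)

end BicolouredMap

/-- A Hurwitz galaxy of type `(g, μ, ν)`. -/
structure HurwitzGalaxy (g : ℕ) {d : ℕ} (μ ν : Composition d) extends BicolouredMap.{v} where
  finite_edge : Finite Edge
  connected : ∀ e f : Edge, ∃ p ∈ Subgroup.closure {white, black}, p e = f
  /-- the label of the white face on the right of an edge -/
  whiteFace : Edge → Fin μ.length
  /-- the label of the black face on the left of an edge -/
  blackFace : Edge → Fin ν.length
  whiteFace_eq_iff : ∀ e f, whiteFace e = whiteFace f ↔ white.SameCycle e f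
  blackFace_eq_iff : ∀ e f, blackFace e = blackFace f ↔ black.SameCycle e f
  card_whiteFace : ∀ i,
    Nat.card {e // whiteFace e = i} = μ.blocksFun i * (branchNumber g μ ν + 1)
  card_blackFace : ∀ j,
    Nat.card {e // blackFace e = j} = ν.blocksFun j * (branchNumber g μ ν + 1)
  /-- the surface has genus `g` -/
  euler : (Nat.card toBicolouredMap.Vertex : ℤ) - Nat.card Edge + (μ.length + ν.length) = 2 - 2 * g
  /-- the colour of a vertex, in `{0, …, b}` (addition in this type is cyclic) -/
  colour : toBicolouredMap.Vertex → Fin (branchNumber g μ ν + 1)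
  colour_target : ∀ e, colour (toBicolouredMap.target e) = colour (toBicolouredMap.source e) + 1
  card_colour_zero : Nat.card {x // colour x = 0} = d
  valency_colour_zero : ∀ x, colour x = 0 → toBicolouredMap.valency x = 2
  card_colour_four : ∀ i, i ≠ 0 →
    Nat.card {x // colour x = i ∧ toBicolouredMap.valency x = 4} = 1
  card_colour_two : ∀ i, i ≠ 0 →
    Nat.card {x // colour x = i ∧ toBicolouredMap.valency x = 2} + 2 = d
  valency_colour : ∀ x, colour x ≠ 0 →
    toBicolouredMap.valency x = 2 ∨ toBicolouredMap.valency x = 4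

namespace HurwitzGalaxy

variable {g d : ℕ} {μ ν : Composition d} (G : HurwitzGalaxy.{v} g μ ν)

/-- The black face `j` is a bubble: exactly one 4-valent vertex lies on its boundary. -/
def IsBlackBubble (j : Fin ν.length) : Prop :=
  Nat.card {x : G.Vertex // G.valency x = 4 ∧ ∃ e, G.blackFace e = j ∧ G.target e = x} = 1

/-- The galaxy is pruned: no black face is a bubble. -/
def IsPruned : Prop := ∀ j, ¬ G.IsBlackBubble j

/-- The colour of the endpoint of an edge. -/
def edgeColour (e : G.Edge) : Fin (branchNumber g μ ν + 1) := G.colour (G.target e)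

theorem edgeColour_white (e : G.Edge) : G.edgeColour (G.white e) = G.edgeColour e + 1 := by
  rw [edgeColour, G.colour_target, G.source_white, edgeColour]

theorem edgeColour_black (e : G.Edge) : G.edgeColour (G.black e) = G.edgeColour e + 1 := by
  rw [edgeColour, G.colour_target, G.source_black, edgeColour]

theorem edgeColour_pow {p : Perm G.Edge} (hp : ∀ e, G.edgeColour (p e) = G.edgeColour e + 1)
    (n : ℕ) (e : G.Edge) :
    G.edgeColour ((p ^ n) e) = G.edgeColour e + Fin.ofNat (branchNumber g μ ν + 1) n := by
  induction n with
  | zero => simp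
  | succ n ih =>
    rw [pow_succ', Perm.mul_apply, hp, ih, add_assoc]
    congr 1
    ext
    simp [Fin.val_add]

theorem edgeColour_inv_pow {p : Perm G.Edge} (hp : ∀ e, G.edgeColour (p e) = G.edgeColour e + 1)
    (e : G.Edge) : G.edgeColour (((p⁻¹) ^ (G.edgeColour e).val) e) = 0 := by
  have h := G.edgeColour_pow hp (G.edgeColour e).val (((p⁻¹) ^ (G.edgeColour e).val) e)
  have h1 : (p ^ (G.edgeColour e).val) (((p⁻¹) ^ (G.edgeColour e).val) e) = e := by
    rw [inv_pow, ← Perm.mul_apply, mul_inv_cancel, Perm.one_apply]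
  rw [h1, Fin.ofNat_val_eq_self] at h
  exact right_eq_add.mp h

/-- A node is placed in each of the two faces of every edge `b → 0`; the white nodes and the black
nodes are both indexed by these edges. -/
def Node : Type v := {e : G.Edge // G.edgeColour e = 0}

/-- The arcs of the polygons, from a node to the next node of the same face, if `p` is `white` or
`black`. -/
def nextNode {p : Perm G.Edge} (hp : ∀ e, G.edgeColour (p e) = G.edgeColour e + 1) :
    Perm G.Node :=
  (p ^ (branchNumber g μ ν + 1)).subtypePerm fun e => by
    have h : Fin.ofNat (branchNumber g μ ν + 1) (branchNumber g μ ν + 1) = 0 := by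
      ext; simp
    rw [G.edgeColour_pow hp, h, add_zero]

/-- The path `0 → 1 → … → b` on the boundary of a face, which contains the corner that follows
the edge `e` in that face, begins at the endpoint of an edge `b → 0`. The node at this edge is the
origin of the arc whose region is incident to the corner. -/
def nodeOf {p : Perm G.Edge} (hp : ∀ e, G.edgeColour (p e) = G.edgeColour e + 1)
    (e : G.Edge) : G.Node :=
  ⟨((p⁻¹) ^ (G.edgeColour e).val) e, G.edgeColour_inv_pow hp e⟩

end HurwitzGalaxy

/-- A marked Hurwitz galaxy: a vertex of colour `0` is distinguished. -/
structure MarkedHurwitzGalaxy (g : ℕ) {d : ℕ} (μ ν : Composition d)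
    extends HurwitzGalaxy.{v} g μ ν where
  root : toBicolouredMap.Vertex
  colour_root : colour root = 0

/-! ### Mobiles -/

/-- A partially oriented graph with white and black nodes, with oriented arcs from every white
(black) node to a white (black) node which form the white (black) polygons, labelled by `Fin m`
(by `Fin n`), and with non-oriented weighted edges with labels in `{0, …, b}`. -/
structure MobileGraph (b m n : ℕ) where
  WhiteNode : Type u
  BlackNode : Type u
  nextWhite : Perm WhiteNode
  nextBlack : Perm BlackNode
  whitePolygon : WhiteNode → Fin m
  blackPolygon : BlackNode → Fin n
  Edge : Type u
  /-- the edge is incident to the node -/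
  Inc : Edge → WhiteNode ⊕ BlackNode → Prop
  weight : Edge → ℕ
  label : Edge → Fin (b + 1)

namespace MobileGraph

variable {b m n : ℕ} (M : MobileGraph.{u} b m n)

/-- Two nodes are joined by an arc or by an edge. -/
inductive Joined : M.WhiteNode ⊕ M.BlackNode → M.WhiteNode ⊕ M.BlackNode → Prop
  | white (x : M.WhiteNode) : Joined (.inl x) (.inl (M.nextWhite x))
  | black (p : M.BlackNode) : Joined (.inr p) (.inr (M.nextBlack p))
  | edge (e : M.Edge) {s t : M.WhiteNode ⊕ M.BlackNode} : M.Inc e s → M.Inc e t → Joined s t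

/-- An isomorphism of labelled mobiles. -/
structure Iso (M : MobileGraph.{u} b m n) (N : MobileGraph.{v} b m n) where
  whiteNode : M.WhiteNode ≃ N.WhiteNode
  blackNode : M.BlackNode ≃ N.BlackNode
  edge : M.Edge ≃ N.Edge
  nextWhite : ∀ x, whiteNode (M.nextWhite x) = N.nextWhite (whiteNode x)
  nextBlack : ∀ p, blackNode (M.nextBlack p) = N.nextBlack (blackNode p)
  whitePolygon : ∀ x, N.whitePolygon (whiteNode x) = M.whitePolygon x
  blackPolygon : ∀ p, N.blackPolygon (blackNode p) = M.blackPolygon p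
  inc : ∀ e s, N.Inc (edge e) (Sum.map whiteNode blackNode s) ↔ M.Inc e s
  weight : ∀ e, N.weight (edge e) = M.weight e
  label : ∀ e, N.label (edge e) = M.label e

/-! #### The contour

White polygons are oriented clockwise and black polygons counter-clockwise. The sector outside the
polygon between a node `s` and the next node (in the orientation) contains the edges incident
to `s`, by increasing label in the direction of the orientation. It is divided into `b + 1` spots
`(s, 0), …, (s, b)`, and the edge of label `c`, if it is incident to `s`, ends at the spot `(s, c)`.
The counter-clockwise path around the mobile has the polygons on its left: it follows the white
polygons against, and the black polygons along, their orientation. Whenever it reaches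
an edge, it follows this edge to its other end. The arc from `s` to the next node is traversed
between spots of `s` and spots of the neighbouring node: on a white polygon just before `(s, b)`
and hence, from `s` to its predecessor, just after `(s, 0)`; on a black one just after `(s, b)`. -/

/-- The spots at which edges may end. -/
abbrev Spot : Type u := (M.WhiteNode ⊕ M.BlackNode) × Fin (b + 1)

/-- The edge `e` ends at the spot `s`. -/
def IsEnd (e : M.Edge) (s : M.Spot) : Prop := M.label e = s.2 ∧ M.Inc e s.1

/-- The next spot of the same polygon, counter-clockwise around the mobile. -/
def advance : M.Spot → M.Spot
  | (.inl x, c) => (.inl (if c = 0 then M.nextWhite.symm x else x), c - 1)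
  | (.inr p, c) => (.inr (if c = Fin.last b then M.nextBlack p else p), c + 1)

/-- The number (0 or 1) of white arcs traversed from `s` to `advance s`. -/
def whiteArc : M.Spot → ℕ
  | (.inl _, c) => if c = 0 then 1 else 0
  | (.inr _, _) => 0

/-- The number (0 or 1) of black arcs traversed from `s` to `advance s`. -/
def blackArc : M.Spot → ℕ
  | (.inl _, _) => 0
  | (.inr _, c) => if c = Fin.last b then 1 else 0

open Classical in
/-- Follow the edge that ends at `s` to its other end; stay at `s` if no edge ends there. -/
noncomputable def cross (s : M.Spot) : M.Spot :=
  if h : ∃ t, t ≠ s ∧ ∃ e, M.IsEnd e s ∧ M.IsEnd e t then h.choose else s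

/-- One step of the counter-clockwise path. -/
noncomputable def step (s : M.Spot) : M.Spot := M.cross (M.advance s)

/-- The counter-clockwise path that arrives at the black node `p` along the edge `y`, and then
traverses the black arc at `p`. -/
noncomputable def path (p : M.BlackNode) (y : M.Edge) (k : ℕ) : M.Spot :=
  M.step^[k] (.inr p, M.label y)

/-- The path reaches an end of the edge `z` in its step `k`. -/
def ReachesAt (p : M.BlackNode) (y z : M.Edge) (k : ℕ) : Prop :=
  M.IsEnd z (M.advance (M.path p y k))

/-- The first step in which the path reaches `z`. -/
noncomputable def firstReach (p : M.BlackNode) (y z : M.Edge) : ℕ :=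
  sInf {k | M.ReachesAt p y z k}

/-- The white distance `d_∘(y, z)`: the number of white arcs traversed until `z` is reached. -/
noncomputable def whiteDist (p : M.BlackNode) (y z : M.Edge) : ℕ :=
  ∑ k ∈ Finset.range (M.firstReach p y z + 1), M.whiteArc (M.path p y k)

/-- The black distance `d_•(y, z)`: the number of black arcs traversed until `z` is reached. -/
noncomputable def blackDist (p : M.BlackNode) (y z : M.Edge) : ℕ :=
  ∑ k ∈ Finset.range (M.firstReach p y z + 1), M.blackArc (M.path p y k)

/-- The edge `y`, which is incident to the black node `p`, is interrupted by the edge `z`. -/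
def IsInterrupted (p : M.BlackNode) (y z : M.Edge) : Prop :=
  M.whiteDist p y z < M.blackDist p y z ∨
    (M.whiteDist p y z = M.blackDist p y z ∧ M.label y < M.label z)

/-- `z` is the next edge after `y`: the first edge other than `y` on the path. -/
def IsNextEdge (p : M.BlackNode) (y z : M.Edge) : Prop :=
  z ≠ y ∧ ∃ k, M.ReachesAt p y z k ∧ ∀ i < k, ∀ e, M.ReachesAt p y e i → e = y

/-- The edge `y` of weight 1 is incident to the black polygon `P` at its node `p`. -/
def IsWeightOneEdge (P : Fin n) (p : M.BlackNode) (y : M.Edge) : Prop :=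
  M.blackPolygon p = P ∧ M.Inc y (.inr p) ∧ M.weight y = 1

/-- The weight 1 edge at `P` has a nonzero label and is interrupted by the next edge. -/
def NonzeroCondition (P : Fin n) : Prop :=
  ∃ p y, M.IsWeightOneEdge P p y ∧ M.label y ≠ 0 ∧
    ∃ z, M.IsNextEdge p y z ∧ M.IsInterrupted p y z

/-- The weight 1 edge `x` at `P` has label `0`, and the next edge has weight 0, or it has weight 1
and is not interrupted by some other edge of nonzero label. -/
def ZeroCondition (P : Fin n) : Prop :=
  ∃ p x, M.IsWeightOneEdge P p x ∧ M.label x = 0 ∧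
    ((∃ y, M.IsNextEdge p x y ∧ M.weight y = 0) ∨
      ∃ y, M.IsNextEdge p x y ∧ ∃ Q q, M.IsWeightOneEdge Q q y ∧
        ∃ z, z ≠ y ∧ M.label z ≠ 0 ∧ ¬ M.IsInterrupted q y z)

end MobileGraph

/-- An edge-labelled Hurwitz mobile of type `(μ, ν)` (in genus 0). -/
structure HurwitzMobile {d : ℕ} (μ ν : Composition d)
    extends MobileGraph.{u} (branchNumber 0 μ ν) μ.length ν.length where
  whitePolygon_eq_iff : ∀ x y, whitePolygon x = whitePolygon y ↔ nextWhite.SameCycle x y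
  blackPolygon_eq_iff : ∀ p q, blackPolygon p = blackPolygon q ↔ nextBlack.SameCycle p q
  card_whitePolygon : ∀ i, Nat.card {x // whitePolygon x = i} = μ.blocksFun i
  card_blackPolygon : ∀ j, Nat.card {p // blackPolygon p = j} = ν.blocksFun j
  card_edge : Nat.card Edge = branchNumber 0 μ ν + 1
  label_injective : Function.Injective label
  inc_of_weight_eq_zero : ∀ e, weight e = 0 →
    ∃ x y : WhiteNode, x ≠ y ∧ ∀ s, Inc e s ↔ s = .inl x ∨ s = .inl y
  inc_of_weight_pos : ∀ e, 0 < weight e →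
    ∃ (x : WhiteNode) (p : BlackNode), ∀ s, Inc e s ↔ s = .inl x ∨ s = .inr p
  sum_whitePolygon : ∀ i,
    ∑ᶠ e ∈ {e | ∃ x, whitePolygon x = i ∧ Inc e (.inl x)}, weight e = μ.blocksFun i
  sum_blackPolygon : ∀ j,
    ∑ᶠ e ∈ {e | ∃ p, blackPolygon p = j ∧ Inc e (.inr p)}, weight e = ν.blocksFun j
  connected : ∀ s t, Relation.EqvGen toMobileGraph.Joined s t

/-! ### The mobile of a marked galaxy -/

namespace MarkedHurwitzGalaxy

variable {g d : ℕ} {μ ν : Composition d} (G : MarkedHurwitzGalaxy.{v} g μ ν)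

/-- The distance labelling: the least number of edges of an oriented path from the root. -/
noncomputable def dist (x : G.Vertex) : ℕ := sInf {n | G.OrientedPath n G.root x}

/-- The weight of an edge. The division is exact and nonnegative, since colours are distances
modulo `b + 1`. -/
noncomputable def weight (e : G.Edge) : ℕ :=
  (G.dist (G.source e) + 1 - G.dist (G.target e)) / (branchNumber g μ ν + 1)

/-- An edge is geodesic if its weight is `0`. -/
def IsGeodesic (e : G.Edge) : Prop := G.weight e = 0

/-- The mobile of a marked galaxy. Its polygons are placed in the faces. Every non-geodesic edge `e`
gives an edge of the same weight between the nodes given by the corners that follow `e` in its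
white and its black face, and every vertex with two incoming geodesic edges gives an edge of weight
`0` between the nodes given by the white corners at this vertex. Labels are colours. -/
noncomputable def mobile : MobileGraph.{v} (branchNumber g μ ν) μ.length ν.length where
  WhiteNode := G.Node
  BlackNode := G.Node
  nextWhite := G.nextNode G.edgeColour_white
  nextBlack := G.nextNode G.edgeColour_black
  whitePolygon a := G.whiteFace a.1
  blackPolygon a := G.blackFace a.1
  Edge := {e : G.Edge // ¬ G.IsGeodesic e} ⊕
    {x : G.Vertex // Nat.card {e : G.Edge // G.target e = x ∧ G.IsGeodesic e} = 2}
  Inc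
    | .inl e, s => s = .inl (G.nodeOf G.edgeColour_white e.1) ∨
        s = .inr (G.nodeOf G.edgeColour_black e.1)
    | .inr x, s => ∃ e : G.Edge, G.target e = x.1 ∧ s = .inl (G.nodeOf G.edgeColour_white e)
  weight
    | .inl e => G.weight e.1
    | .inr _ => 0
  label
    | .inl e => G.edgeColour e.1
    | .inr x => G.colour x.1

end MarkedHurwitzGalaxy

/-- The mobile `M` is in standard form, and the marked galaxy `G` corresponds to it: `M` is the
mobile of `G`. -/
def HurwitzMobile.IsMobileOf {d : ℕ} {μ ν : Composition d} (M : HurwitzMobile.{u} μ ν)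
    (G : MarkedHurwitzGalaxy.{v} 0 μ ν) : Prop :=
  Nonempty (M.toMobileGraph.Iso G.mobile)

/-! Weights telescope around a black face and add up to 1 (`sum_weight_black_pow`), so each black
face contains exactly one non-geodesic edge `e`. It gives the weight-1 edge of the polygon, and from
the endpoint of `e` distances grow by one per step along the face (`dist_black_pow`).

The contour of the mobile is read in the galaxy: spots become corners of faces. A step in a black
face raises a distance label by 1, a step in a white face lowers it by 1, crossing a mobile edge
preserves it, and arcs are traversed exactly where the colour wraps around. Hence comparing white
and black arcs, with labels breaking ties, amounts to comparing distances: `y` is interrupted by `z`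
iff the vertex of `z` is farther from the root than that of `y` (`isInterrupted_iff`).

From `e` the contour runs once around the black face, crosses `e`, and returns along the outside of
the face. The first edge it then meets sits at the last 4-valent vertex after `e` on the face
(`isNext_of_isEnd_rot`), which is farther away than the endpoint of `e`. If `e` has nonzero colour,
its endpoint is 4-valent, so the face is a bubble iff no later vertex is 4-valent; the contour then
moves on along geodesic edges towards the root, and the next edge is closer (`dist_lt_of_isNext`).

If `e` has colour 0, it ends at the root, which is 2-valent. In a bubble every path leaving the face
passes through its only 4-valent vertex. So the next edge has weight 1, sits at that vertex, and is
interrupted by all other edges of nonzero label, as these lie farther away. Otherwise the next edge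
has weight 0, or an earlier 4-valent vertex of the face carries an edge that does not interrupt it.
Condition (b) speaks of arbitrary edges, so the contour must reach them all; this is a tree argument
(`exists_perm_sameCycle`). -/

/-! ### Joining the cycles of a permutation by transpositions -/

namespace Equiv.Perm

variable {α : Type*}

theorem SameCycle.rel_of_forall_rel {σ : Perm α} {r : Setoid α} (h : ∀ x, r x (σ x)) {x y : α}
    (hxy : σ.SameCycle x y) : r x y := by
  obtain ⟨n, rfl⟩ := hxy
  induction n using Int.induction_on with
  | zero => exact r.refl _
  | succ n ih =>
    rw [add_comm, zpow_add, zpow_one, mul_apply]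
    exact r.trans ih (h _)
  | pred n ih =>
    refine r.trans ih (r.symm ?_)
    have h1 := h ((σ ^ (-(n : ℤ) - 1)) x)
    rwa [← mul_apply, ← zpow_one_add, add_sub_cancel] at h1

variable [DecidableEq α]

/-- The new permutation sends `b` to `σ a` and then follows `σ` around the old cycle of `a`. This
cycle avoids `b`, so the walk closes up at `a`. -/
theorem sameCycle_mul_swap_self [Finite α] {σ : Perm α} {a b : α} (h : ¬ σ.SameCycle a b) :
    (σ * swap a b).SameCycle b a := by
  have key : ∀ n : ℕ, (σ * swap a b).SameCycle b ((σ ^ (n + 1)) a) := by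
    intro n
    induction n with
    | zero => exact ⟨1, by simp⟩
    | succ n ih =>
      rw [pow_succ', mul_apply]
      generalize hy : (σ ^ (n + 1)) a = y at *
      by_cases hya : y = a
      · subst hya
        exact ⟨1, by simp⟩
      · have hyb : y ≠ b := by
          rintro rfl
          exact h ⟨(n + 1 : ℕ), by rw [zpow_natCast, hy]⟩
        refine ih.trans ⟨1, ?_⟩
        simp [swap_apply_of_ne_of_ne hya hyb]
  obtain ⟨i, hi, -, h'⟩ := (SameCycle.refl σ a).exists_pow_eq''
  obtain ⟨n, rfl⟩ : ∃ n, i = n + 1 := ⟨i - 1, by omega⟩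
  simpa [h'] using key n

theorem SameCycle.mul_swap [Finite α] {σ : Perm α} {a b x y : α} (h : ¬ σ.SameCycle a b)
    (hxy : σ.SameCycle x y) : (σ * swap a b).SameCycle x y := by
  have hba := sameCycle_mul_swap_self h
  refine SameCycle.rel_of_forall_rel (r := SameCycle.setoid (σ * swap a b)) (fun z => ?_) hxy
  change (σ * swap a b).SameCycle z (σ z)
  by_cases hza : z = a
  · subst hza
    exact hba.symm.trans ⟨1, by simp⟩
  by_cases hzb : z = b
  · subst hzb
    exact hba.trans ⟨1, by simp⟩
  exact ⟨1, by simp [swap_apply_of_ne_of_ne hza hzb]⟩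

/-- Identifying the old cycles of `a` and `b` gives an invariant `φ` of the new cycles, so old
cycles other than that of `a` yield distinct new ones. -/
theorem card_cycles_le_card_cycles_mul_swap [Finite α] (σ : Perm α) (a b : α) :
    Nat.card (Quotient (SameCycle.setoid σ)) ≤
      Nat.card (Quotient (SameCycle.setoid (σ * swap a b))) + 1 := by
  classical
  let q : α → Quotient (SameCycle.setoid σ) := Quotient.mk _
  have hq : ∀ x, q (σ x) = q x := fun x => Quotient.sound (SameCycle.symm ⟨1, by simp⟩)
  let φ : α → Quotient (SameCycle.setoid σ) := fun x => if q x = q a then q b else q x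
  have hφ : ∀ x y, (σ * swap a b).SameCycle x y → φ x = φ y := by
    intro x y hxy
    refine SameCycle.rel_of_forall_rel (r := Setoid.ker φ) (fun z => ?_) hxy
    change φ z = φ ((σ * swap a b) z)
    by_cases hza : z = a
    · subst hza
      simp only [φ, mul_apply, swap_apply_left, hq]
      simp
    by_cases hzb : z = b
    · subst hzb
      simp only [φ, mul_apply, swap_apply_right, hq]
      simp
    simp only [φ, mul_apply, swap_apply_of_ne_of_ne hza hzb, hq]
  let f : Quotient (SameCycle.setoid σ) → Option (Quotient (SameCycle.setoid (σ * swap a b))) :=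
    fun c => if c = q a then none else some (Quotient.mk _ c.out)
  have hf : Function.Injective f := by
    intro c c' hcc
    simp only [f] at hcc
    have hc : q c.out = c := c.out_eq
    have hc' : q c'.out = c' := c'.out_eq
    split_ifs at hcc with h1 h2 h2
    · rw [h1, h2]
    · have h3 := hφ _ _ (Quotient.exact (Option.some.inj hcc))
      simp only [φ, hc, hc', if_neg h1, if_neg h2] at h3
      exact h3
  have := Nat.card_le_card_of_injective f hf
  rwa [Finite.card_option] at this

/-- A permutation whose cycles are joined to each other by `L` has at most `L.length + 1` cycles,
and in case of equality its product with the transpositions in `L` is a single cycle. -/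
theorem card_cycles_le_and_sameCycle_mul_prod [Finite α] (L : List (α × α)) (σ : Perm α)
    (h : ∀ r : Setoid α, (∀ x, r x (σ x)) → (∀ p ∈ L, r p.1 p.2) → ∀ x y, r x y) :
    Nat.card (Quotient (SameCycle.setoid σ)) ≤ L.length + 1 ∧
      (Nat.card (Quotient (SameCycle.setoid σ)) = L.length + 1 →
        ∀ x y, (σ * (L.map fun p => swap p.1 p.2).prod).SameCycle x y) := by
  induction L generalizing σ with
  | nil =>
    have h1 : ∀ x y, σ.SameCycle x y :=
      h (SameCycle.setoid σ) (fun x => ⟨1, by simp⟩) (by simp)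
    refine ⟨?_, fun _ => by simpa using h1⟩
    have : Subsingleton (Quotient (SameCycle.setoid σ)) := by
      refine ⟨fun c c' => ?_⟩
      induction c using Quotient.inductionOn
      induction c' using Quotient.inductionOn
      exact Quotient.sound (h1 _ _)
    simpa using Finite.card_le_one_iff_subsingleton.mpr this
  | cons p L ih =>
    obtain ⟨a, b⟩ := p
    by_cases hab : σ.SameCycle a b
    · have h1 := ih σ fun r hr hL => h r hr fun p hp => by
        rcases List.mem_cons.mp hp with rfl | hp
        · exact hab.rel_of_forall_rel hr
        · exact hL p hp
      refine ⟨h1.1.trans (by simp), fun h2 => ?_⟩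
      have := h1.1
      rw [h2, List.length_cons] at this
      omega
    · have h1 := ih (σ * swap a b) fun r hr hL => h r
        (fun x => (SameCycle.mul_swap hab ⟨1, by simp⟩).rel_of_forall_rel hr)
        fun p hp => by
          rcases List.mem_cons.mp hp with rfl | hp
          · exact (sameCycle_mul_swap_self hab).symm.rel_of_forall_rel hr
          · exact hL p hp
      have h2 := card_cycles_le_card_cycles_mul_swap σ a b
      rw [List.length_cons]
      refine ⟨by omega, fun h3 => ?_⟩
      have h4 := h1.2 (by omega)
      simpa [mul_assoc] using h4

/-- The list holds one element from each of some 2-element orbits of the involution, so the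
transpositions are disjoint. It is applied to the rotation at the double vertices. -/
theorem prod_map_swap_apply {τ : α → α} (hτ : ∀ x, τ (τ x) = x) {l : List α} (hl : l.Nodup)
    (hl' : ∀ x ∈ l, τ x ∉ l) (x : α) :
    (l.map fun y => swap y (τ y)).prod x = if x ∈ l ∨ τ x ∈ l then τ x else x := by
  induction l with
  | nil => simp
  | cons a l ih =>
    rw [List.map_cons, List.prod_cons, mul_apply,
      ih hl.of_cons fun y hy h => hl' y (.tail _ hy) (.tail _ h)]
    simp only [List.nodup_cons] at hl
    have h1 := hl' a (by simp)
    have h2 := hτ x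
    have h3 := hτ a
    rw [swap_apply_def]
    grind

end Equiv.Perm

/-! ### The rotation at a vertex and the local structure of galaxies -/

namespace BicolouredMap

variable (G : BicolouredMap.{v})

/-- The rotation of the incoming edges around their endpoints. -/
def rot : Perm G.Edge := G.black⁻¹ * G.white

variable {G}

theorem target_eq_target_iff_sameCycle {e f : G.Edge} :
    G.target e = G.target f ↔ G.rot.SameCycle e f :=
  Quotient.eq

theorem target_rot (e : G.Edge) : G.target (G.rot e) = G.target e :=
  target_eq_target_iff_sameCycle.mpr (Perm.SameCycle.symm ⟨1, by simp⟩)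

theorem exists_target_eq (x : G.Vertex) : ∃ e, G.target e = x :=
  Quotient.exists_rep x

theorem black_rot (e : G.Edge) : G.black (G.rot e) = G.white e := by
  simp [rot]

theorem rot_eq_self_iff {e : G.Edge} : G.rot e = e ↔ G.white e = G.black e := by
  rw [← black_rot, G.black.apply_eq_iff_eq]

end BicolouredMap

namespace HurwitzGalaxy

open BicolouredMap

section General

variable {g d : ℕ} {μ ν : Composition d} (G : HurwitzGalaxy.{v} g μ ν)

theorem valency_eq_two_or_four (x : G.Vertex) : G.valency x = 2 ∨ G.valency x = 4 := by
  by_cases h : G.colour x = 0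
  · exact .inl (G.valency_colour_zero x h)
  · exact G.valency_colour x h

theorem card_incoming (x : G.Vertex) :
    Nat.card {e // G.target e = x} = 1 ∨ Nat.card {e // G.target e = x} = 2 := by
  have := G.valency_eq_two_or_four x
  unfold valency at this
  omega

theorem rot_rot (e : G.Edge) : G.rot (G.rot e) = e := by
  classical
  have := G.finite_edge
  by_contra h
  have h1 : G.rot e ≠ e := fun h' => h (by rw [h', h'])
  have h2 : G.rot (G.rot e) ≠ G.rot e := fun h' => h1 (G.rot.injective h')
  have h3 : ({e, G.rot e, G.rot (G.rot e)} : Finset G.Edge).card = 3 :=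
    Finset.card_eq_three.mpr ⟨_, _, _, h1.symm, Ne.symm h, h2.symm, rfl⟩
  have h4 : (({e, G.rot e, G.rot (G.rot e)} : Finset G.Edge) : Set G.Edge).ncard ≤
      {f | G.target f = G.target e}.ncard := by
    refine Set.ncard_le_ncard (fun f hf => ?_) (Set.toFinite _)
    simp only [Finset.coe_insert, Finset.coe_singleton, Set.mem_insert_iff,
      Set.mem_singleton_iff] at hf
    rcases hf with rfl | rfl | rfl <;> simp [target_rot]
  rw [Set.ncard_coe_finset, h3, ← Nat.card_coe_set_eq] at h4
  rcases G.card_incoming (G.target e) with h5 | h5 <;>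
    · simp only [Set.coe_ofPred] at h4
      omega

theorem white_rot (e : G.Edge) : G.white (G.rot e) = G.black e := by
  rw [← black_rot, rot_rot]

/-- This governs the walk back along the outside of a black face: it stays next to the face while
the vertices are 2-valent and turns to `rot e` at a 4-valent one. -/
theorem white_inv_black (e : G.Edge) : G.white⁻¹ (G.black e) = G.rot e := by
  rw [← white_rot]; simp

theorem target_eq_target_iff {e f : G.Edge} :
    G.target f = G.target e ↔ f = e ∨ f = G.rot e := by
  constructor
  · intro h
    have h1 : G.rot.SameCycle e f := target_eq_target_iff_sameCycle.mp h.symm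
    let r : Setoid G.Edge :=
      ⟨fun e f => f = e ∨ f = G.rot e, fun _ => .inl rfl, by
        rintro x y (rfl | rfl)
        · exact .inl rfl
        · exact .inr (G.rot_rot x).symm, by
        rintro x y z (rfl | rfl) (rfl | rfl)
        · exact .inl rfl
        · exact .inr rfl
        · exact .inr rfl
        · exact .inl (G.rot_rot x)⟩
    exact h1.rel_of_forall_rel (r := r) fun x => .inr rfl
  · rintro (rfl | rfl)
    · rfl
    · exact target_rot e

theorem valency_target_eq_four_iff {e : G.Edge} :
    G.valency (G.target e) = 4 ↔ G.rot e ≠ e := by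
  classical
  have := G.finite_edge
  have h1 : {f | G.target f = G.target e} = {e, G.rot e} := by
    ext f
    simp [G.target_eq_target_iff]
  have h2 : G.valency (G.target e) = 2 * ({e, G.rot e} : Set G.Edge).ncard := by
    rw [← h1, ← Nat.card_coe_set_eq]
    rfl
  rw [h2]
  by_cases h : G.rot e = e
  · simp [h]
  · rw [Set.ncard_pair (Ne.symm h)]
    simp [h]

theorem rot_eq_self_of_edgeColour_eq_zero {e : G.Edge} (h : G.edgeColour e = 0) :
    G.rot e = e := by
  by_contra h1
  have h2 := G.valency_target_eq_four_iff.mpr h1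
  rw [G.valency_colour_zero _ h] at h2
  omega

theorem edgeColour_rot (e : G.Edge) : G.edgeColour (G.rot e) = G.edgeColour e := by
  rw [edgeColour, target_rot, edgeColour]

theorem eq_black_or_white_of_source_eq {e f : G.Edge} (h : G.source f = G.target e) :
    f = G.black e ∨ f = G.white e := by
  rcases (G.target_eq_target_iff.mp h) with h | h
  · exact .inr (by rw [← h]; simp)
  · exact .inl (by rw [← white_rot, ← h]; simp)

theorem blackFace_black (e : G.Edge) : G.blackFace (G.black e) = G.blackFace e :=
  (G.blackFace_eq_iff _ _).mpr (Perm.SameCycle.symm ⟨1, by simp⟩)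

theorem blackFace_black_pow (n : ℕ) (e : G.Edge) :
    G.blackFace ((G.black ^ n) e) = G.blackFace e :=
  (G.blackFace_eq_iff _ _).mpr (Perm.SameCycle.symm ⟨n, by simp⟩)

/-- Inverses need no separate hypothesis: on a finite set, a permutation that preserves a predicate
also reflects it. -/
theorem induction_edge {p : G.Edge → Prop} (hw : ∀ e, p e → p (G.white e))
    (hb : ∀ e, p e → p (G.black e)) {e₀ : G.Edge} (h : p e₀) (e : G.Edge) : p e := by
  have := G.finite_edge
  obtain ⟨q, hq, rfl⟩ := G.connected e₀ e
  have key : ∀ f, p f ↔ p (q f) := by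
    induction hq using Subgroup.closure_induction with
    | mem q hq =>
      have inv : (∀ e, p e → p (q e)) → ∀ f, p f ↔ p (q f) := fun hq f =>
        ⟨hq f, fun hf => by simpa using Perm.perm_symm_on_of_perm_on_finite hq hf⟩
      rcases hq with rfl | rfl
      · exact inv hw
      · exact inv hb
    | one => simp
    | mul q r _ _ h1 h2 => exact fun f => (h2 f).trans (h1 _)
    | inv q _ h1 => exact fun f => by simpa using (h1 (q⁻¹ f)).symm
  exact (key _).mp h

theorem blackFace_surjective : Function.Surjective G.blackFace := by
  intro j
  have h1 := G.card_blackFace j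
  have h2 := ν.one_le_blocksFun j
  have h3 : 0 < Nat.card {e // G.blackFace e = j} := by rw [h1]; positivity
  obtain ⟨e, he⟩ := (Nat.card_pos_iff.mp h3).1.some
  exact ⟨e, he⟩

theorem whiteFace_surjective : Function.Surjective G.whiteFace := by
  intro j
  have h1 := G.card_whiteFace j
  have h2 := μ.one_le_blocksFun j
  have h3 : 0 < Nat.card {e // G.whiteFace e = j} := by rw [h1]; positivity
  obtain ⟨e, he⟩ := (Nat.card_pos_iff.mp h3).1.some
  exact ⟨e, he⟩

end General

/-! ### Black faces of degree 1 -/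

section Simple

variable {g d : ℕ} {μ : Composition d} (G : HurwitzGalaxy.{v} g μ (Composition.ones d))

/-- A black face of degree 1 has `b + 1` edges, and its boundary runs through all `b + 1` colours.
-/
theorem eq_of_blackFace_eq_of_edgeColour_eq {e f : G.Edge} (h : G.blackFace e = G.blackFace f)
    (h' : G.edgeColour e = G.edgeColour f) : e = f := by
  have := G.finite_edge
  have h1 : Function.Surjective
      fun e : {e // G.blackFace e = G.blackFace f} => G.edgeColour e.1 := by
    intro c
    refine ⟨⟨(G.black ^ (c - G.edgeColour f).val) f, G.blackFace_black_pow _ _⟩, ?_⟩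
    simp [G.edgeColour_pow G.edgeColour_black]
  have h2 := (Nat.bijective_iff_surjective_and_card
    fun e : {e // G.blackFace e = G.blackFace f} => G.edgeColour e.1).mpr ⟨h1, by
      rw [G.card_blackFace, Composition.ones_blocksFun, one_mul, Nat.card_fin]⟩
  exact congrArg Subtype.val (@h2.1 ⟨e, h⟩ ⟨f, rfl⟩ h')

theorem edgeColour_black_pow (n : ℕ) (e : G.Edge) : G.edgeColour ((G.black ^ n) e) =
    G.edgeColour e + Fin.ofNat (branchNumber g μ (Composition.ones d) + 1) n :=
  G.edgeColour_pow G.edgeColour_black n e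

theorem black_pow_branchNumber (e : G.Edge) :
    (G.black ^ (branchNumber g μ (Composition.ones d) + 1)) e = e := by
  refine G.eq_of_blackFace_eq_of_edgeColour_eq (G.blackFace_black_pow _ _) ?_
  rw [G.edgeColour_black_pow]
  simp

theorem exists_black_pow_eq {e f : G.Edge} (h : G.blackFace e = G.blackFace f) :
    ∃ i ≤ branchNumber g μ (Composition.ones d), e = (G.black ^ i) f := by
  refine ⟨(G.edgeColour e - G.edgeColour f).val, by omega, ?_⟩
  refine G.eq_of_blackFace_eq_of_edgeColour_eq (by rw [G.blackFace_black_pow, h]) ?_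
  rw [G.edgeColour_black_pow]
  simp

theorem black_pow_injOn {i j : ℕ} (hi : i ≤ branchNumber g μ (Composition.ones d))
    (hj : j ≤ branchNumber g μ (Composition.ones d)) {e : G.Edge}
    (h : (G.black ^ i) e = (G.black ^ j) e) : i = j := by
  have h1 := congrArg G.edgeColour h
  rw [G.edgeColour_black_pow, G.edgeColour_black_pow, add_right_inj] at h1
  have h2 := congrArg Fin.val h1
  simpa [Nat.mod_eq_of_lt (Nat.lt_succ_of_le hi), Nat.mod_eq_of_lt (Nat.lt_succ_of_le hj)] using h2

theorem isBlackBubble_iff (j : Fin (Composition.ones d).length) :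
    G.IsBlackBubble j ↔ ∃! e, G.blackFace e = j ∧ G.rot e ≠ e := by
  unfold IsBlackBubble
  have h1 : Nat.card {x : G.Vertex // G.valency x = 4 ∧ ∃ e, G.blackFace e = j ∧ G.target e = x} =
      Nat.card {e // G.blackFace e = j ∧ G.rot e ≠ e} := by
    symm
    refine Nat.card_congr (Equiv.ofBijective
      (fun e => ⟨G.target e.1, G.valency_target_eq_four_iff.mpr e.2.2, e.1, e.2.1, rfl⟩)
      ⟨fun e f h => ?_, fun x => ?_⟩)
    · refine Subtype.ext (G.eq_of_blackFace_eq_of_edgeColour_eq (e.2.1.trans f.2.1.symm) ?_)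
      exact congrArg G.colour (congrArg Subtype.val h)
    · obtain ⟨x, hx, e, he, rfl⟩ := x
      exact ⟨⟨e, he, G.valency_target_eq_four_iff.mp hx⟩, rfl⟩
  rw [h1, Nat.card_eq_one_iff_unique, ← unique_subtype_iff_existsUnique]
  constructor
  · rintro ⟨h2, ⟨x⟩⟩
    exact ⟨⟨⟨x⟩, fun y => Subsingleton.elim _ _⟩⟩
  · rintro ⟨h2⟩
    exact ⟨⟨fun x y => (h2.2 x).trans (h2.2 y).symm⟩, ⟨h2.1.1⟩⟩

/-- If all vertices of the face were 2-valent, `white` and `black` would agree on its edges. By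
connectedness the face would contain all edges, although there are at least two black faces. -/
theorem exists_rot_ne (hd : 2 ≤ d) (j : Fin (Composition.ones d).length) :
    ∃ e, G.blackFace e = j ∧ G.rot e ≠ e := by
  by_contra! h
  obtain ⟨e₀, h0⟩ := G.blackFace_surjective j
  have h1 : ∀ e, G.blackFace e = j :=
    G.induction_edge (p := fun e => G.blackFace e = j)
      (fun e he => by rw [rot_eq_self_iff.mp (h e he), blackFace_black, he])
      (fun e he => by rw [blackFace_black, he]) h0
  have : Nontrivial (Fin (Composition.ones d).length) :=
    Fin.nontrivial_iff_two_le.mpr (by rwa [Composition.ones_length])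
  obtain ⟨j', hj'⟩ := exists_ne j
  obtain ⟨e, he⟩ := G.blackFace_surjective j'
  exact hj' (he.symm.trans (h1 e))

end Simple

end HurwitzGalaxy

/-! ### Distances, weights and geodesic edges -/

namespace MarkedHurwitzGalaxy

open BicolouredMap HurwitzGalaxy

section General

variable {g d : ℕ} {μ ν : Composition d} (G : MarkedHurwitzGalaxy.{v} g μ ν)

theorem exists_orientedPath (x : G.Vertex) : ∃ n, G.OrientedPath n G.root x := by
  obtain ⟨e₀, h0⟩ := exists_target_eq G.root
  obtain ⟨e, rfl⟩ := exists_target_eq x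
  refine G.induction_edge (p := fun e => ∃ n, G.OrientedPath n G.root (G.target e))
    ?_ ?_ (e₀ := e₀) ⟨0, by rw [h0]; exact .nil _⟩ e
  · rintro e ⟨n, h⟩
    exact ⟨n + 1, .snoc _ (by rwa [source_white])⟩
  · rintro e ⟨n, h⟩
    exact ⟨n + 1, .snoc _ (by rwa [source_black])⟩

theorem orientedPath_dist (x : G.Vertex) : G.OrientedPath (G.dist x) G.root x :=
  Nat.sInf_mem (s := {n | G.OrientedPath n G.root x}) (G.exists_orientedPath x)

variable {G} in
theorem dist_le {n : ℕ} {x : G.Vertex} (h : G.OrientedPath n G.root x) : G.dist x ≤ n :=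
  Nat.sInf_le h

theorem dist_root : G.dist G.root = 0 :=
  Nat.le_zero.mp (dist_le (.nil _))

theorem dist_target_le (e : G.Edge) : G.dist (G.target e) ≤ G.dist (G.source e) + 1 :=
  dist_le (.snoc e (G.orientedPath_dist _))

variable {G} in
theorem colour_of_orientedPath {n : ℕ} {x : G.Vertex} (h : G.OrientedPath n G.root x) :
    G.colour x = Fin.ofNat (branchNumber g μ ν + 1) n := by
  generalize hr : G.root = r at h
  induction h with
  | nil => subst hr; rw [G.colour_root]; rfl
  | snoc e _ ih =>
    rw [G.colour_target, ih hr]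
    ext
    simp [Fin.val_add]

theorem colour_eq_dist (x : G.Vertex) :
    G.colour x = Fin.ofNat (branchNumber g μ ν + 1) (G.dist x) :=
  colour_of_orientedPath (G.orientedPath_dist x)

/-- Neither the subtraction nor the division in `weight` loses anything: distances grow by at most 1
along an edge, and colours are distances modulo `b + 1`. -/
theorem weight_mul_add (e : G.Edge) :
    G.weight e * (branchNumber g μ ν + 1) + G.dist (G.target e) = G.dist (G.source e) + 1 := by
  have h1 := G.dist_target_le e
  have h2 : branchNumber g μ ν + 1 ∣ G.dist (G.source e) + 1 - G.dist (G.target e) := by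
    refine (Nat.modEq_iff_dvd' h1).mp ?_
    have h3 := congrArg Fin.val (G.colour_target e)
    rw [colour_eq_dist, colour_eq_dist] at h3
    simpa [Fin.val_add, Nat.ModEq] using h3
  rw [weight, Nat.div_mul_cancel h2]
  omega

theorem isGeodesic_iff (e : G.Edge) :
    G.IsGeodesic e ↔ G.dist (G.target e) = G.dist (G.source e) + 1 := by
  have h := G.weight_mul_add e
  unfold IsGeodesic
  constructor
  · intro h0
    rwa [h0, zero_mul, zero_add] at h
  · intro h0
    rw [h0] at h
    simpa using h

theorem exists_isGeodesic {x : G.Vertex} (hx : x ≠ G.root) :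
    ∃ e, G.target e = x ∧ G.IsGeodesic e := by
  have h := G.orientedPath_dist x
  generalize hn : G.dist x = n at h
  cases h with
  | nil => exact absurd rfl hx
  | snoc e h =>
    refine ⟨e, rfl, (G.isGeodesic_iff e).mpr ?_⟩
    have h1 := dist_le h
    have h2 := G.dist_target_le e
    omega

theorem isGeodesic_rot_of_ne_root {e : G.Edge} (he : ¬ G.IsGeodesic e)
    (h : G.target e ≠ G.root) : G.IsGeodesic (G.rot e) := by
  obtain ⟨f, hf, hf'⟩ := G.exists_isGeodesic h
  rcases G.target_eq_target_iff.mp hf with rfl | rfl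
  · exact absurd hf' he
  · exact hf'

theorem eq_root_of_edgeColour_eq_zero {e : G.Edge} (he : ¬ G.IsGeodesic e)
    (h : G.edgeColour e = 0) : G.target e = G.root := by
  by_contra h1
  have := G.isGeodesic_rot_of_ne_root he h1
  rw [G.rot_eq_self_of_edgeColour_eq_zero h] at this
  exact he this

theorem isGeodesic_rot {e : G.Edge} (he : ¬ G.IsGeodesic e) (h : G.edgeColour e ≠ 0) :
    G.IsGeodesic (G.rot e) := by
  refine G.isGeodesic_rot_of_ne_root he fun h1 => h ?_
  rw [edgeColour, h1, G.colour_root]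

theorem rot_ne_of_not_isGeodesic {e : G.Edge} (he : ¬ G.IsGeodesic e)
    (h : G.edgeColour e ≠ 0) : G.rot e ≠ e := fun h1 =>
  he (h1 ▸ G.isGeodesic_rot he h)

/-- The vertices with two incoming geodesic edges. -/
def IsDouble (x : G.Vertex) : Prop :=
  Nat.card {e : G.Edge // G.target e = x ∧ G.IsGeodesic e} = 2

theorem isDouble_target_iff {e : G.Edge} :
    G.IsDouble (G.target e) ↔ G.rot e ≠ e ∧ G.IsGeodesic e ∧ G.IsGeodesic (G.rot e) := by
  classical
  have := G.finite_edge
  have h1 : G.IsDouble (G.target e) ↔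
      {f | G.target f = G.target e ∧ G.IsGeodesic f}.ncard = 2 := Iff.rfl
  have hsub : {f | G.target f = G.target e ∧ G.IsGeodesic f} ⊆ {e, G.rot e} := by
    rintro f ⟨hf, -⟩
    simpa using G.target_eq_target_iff.mp hf
  rw [h1]
  constructor
  · intro h
    have hne : G.rot e ≠ e := by
      intro h2
      have := Set.ncard_le_ncard hsub (Set.toFinite _)
      rw [h, h2, Set.pair_eq_singleton, Set.ncard_singleton] at this
      omega
    have heq := Set.eq_of_subset_of_ncard_le hsub
      (by rw [h, Set.ncard_pair hne.symm]) (Set.toFinite _)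
    have h3 : e ∈ ({e, G.rot e} : Set G.Edge) := by simp
    have h4 : G.rot e ∈ ({e, G.rot e} : Set G.Edge) := by simp
    rw [← heq] at h3 h4
    exact ⟨hne, h3.2, h4.2⟩
  · rintro ⟨hne, h3, h4⟩
    have heq : {f | G.target f = G.target e ∧ G.IsGeodesic f} = {e, G.rot e} := by
      refine hsub.antisymm ?_
      rintro f (rfl | rfl)
      · exact ⟨rfl, h3⟩
      · exact ⟨target_rot e, h4⟩
    rw [heq, Set.ncard_pair hne.symm]

end General

section Simple

variable {g d : ℕ} {μ : Composition d} (G : MarkedHurwitzGalaxy.{v} g μ (Composition.ones d))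

theorem sum_weight_black_pow (e : G.Edge) :
    ∑ i ∈ Finset.range (branchNumber g μ (Composition.ones d) + 1),
      G.weight ((G.black ^ i) e) = 1 := by
  -- The distances telescope; after `b + 1` edges the walk is back at its start and only the length
  -- `b + 1` is left.
  have key : ∀ n, (∑ i ∈ Finset.range n, G.weight ((G.black ^ i) e)) *
      (branchNumber g μ (Composition.ones d) + 1) + G.dist (G.source ((G.black ^ n) e)) =
        G.dist (G.source e) + n := by
    intro n
    induction n with
    | zero => simp
    | succ n ih =>
      have h := G.weight_mul_add ((G.black ^ n) e)
      rw [Finset.sum_range_succ, add_mul, pow_succ', Perm.mul_apply, source_black]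
      omega
  have h := key (branchNumber g μ (Composition.ones d) + 1)
  rw [G.black_pow_branchNumber] at h
  exact Nat.eq_of_mul_eq_mul_right
    (Nat.succ_pos (branchNumber g μ (Composition.ones d))) (by rw [Nat.succ_eq_add_one]; omega)

theorem exists_not_isGeodesic (j : Fin (Composition.ones d).length) :
    ∃ e, G.blackFace e = j ∧ ¬ G.IsGeodesic e := by
  obtain ⟨e, rfl⟩ := G.blackFace_surjective j
  by_contra! h
  have h1 := G.sum_weight_black_pow e
  rw [Finset.sum_eq_zero fun i _ => h _ (G.blackFace_black_pow i e)] at h1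
  omega

variable {G}

theorem weight_eq_one {e : G.Edge} (he : ¬ G.IsGeodesic e) : G.weight e = 1 := by
  have h1 := G.sum_weight_black_pow e
  rw [Finset.sum_range_succ'] at h1
  have h2 : G.weight ((G.black ^ 0) e) ≠ 0 := he
  rw [pow_zero, Perm.one_apply] at h1 h2
  omega

theorem isGeodesic_black_pow {e : G.Edge} (he : ¬ G.IsGeodesic e) {i : ℕ} (h0 : 1 ≤ i)
    (hi : i ≤ branchNumber g μ (Composition.ones d)) : G.IsGeodesic ((G.black ^ i) e) := by
  have h1 := G.sum_weight_black_pow e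
  rw [Finset.sum_range_succ', pow_zero, Perm.one_apply, weight_eq_one he] at h1
  have h2 := Finset.sum_eq_zero_iff.mp (Nat.succ_injective h1) (i - 1)
    (Finset.mem_range.mpr (by omega))
  rwa [Nat.sub_add_cancel h0] at h2

theorem eq_of_not_isGeodesic {e f : G.Edge} (he : ¬ G.IsGeodesic e) (hf : ¬ G.IsGeodesic f)
    (h : G.blackFace e = G.blackFace f) : e = f := by
  obtain ⟨i, hi, rfl⟩ := G.exists_black_pow_eq h
  rcases Nat.eq_zero_or_pos i with rfl | h0
  · simp
  · exact absurd (isGeodesic_black_pow hf h0 hi) he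

theorem dist_black_pow {e : G.Edge} (he : ¬ G.IsGeodesic e) {i : ℕ}
    (hi : i ≤ branchNumber g μ (Composition.ones d)) :
    G.dist (G.target ((G.black ^ i) e)) = G.dist (G.target e) + i := by
  induction i with
  | zero => simp
  | succ i ih =>
    rw [(G.isGeodesic_iff _).mp (isGeodesic_black_pow he (by omega) hi), pow_succ',
      Perm.mul_apply, source_black, ih (by omega), add_assoc]

end Simple

end MarkedHurwitzGalaxy

/-! ### Nodes of the polygons -/

namespace HurwitzGalaxy

open BicolouredMap

variable {g d : ℕ} {μ ν : Composition d} {G : HurwitzGalaxy.{v} g μ ν}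

theorem nodeOf_val {p : Perm G.Edge}
    (hp : ∀ e, G.edgeColour (p e) = G.edgeColour e + 1) (e : G.Edge) :
    (G.nodeOf hp e).1 = (p⁻¹ ^ (G.edgeColour e).val) e := rfl

theorem nextNode_val {p : Perm G.Edge}
    (hp : ∀ e, G.edgeColour (p e) = G.edgeColour e + 1) (a : G.Node) :
    (G.nextNode hp a).1 = (p ^ (branchNumber g μ ν + 1)) a.1 := rfl

theorem pow_edgeColour_nodeOf {p : Perm G.Edge}
    (hp : ∀ e, G.edgeColour (p e) = G.edgeColour e + 1) (e : G.Edge) :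
    (p ^ (G.edgeColour e).val) (G.nodeOf hp e).1 = e := by
  rw [nodeOf_val, inv_pow, ← Perm.mul_apply, mul_inv_cancel, Perm.one_apply]

theorem nodeOf_eq_nodeOf_iff {p : Perm G.Edge}
    (hp : ∀ e, G.edgeColour (p e) = G.edgeColour e + 1) {e f : G.Edge}
    (h : G.edgeColour e = G.edgeColour f) : G.nodeOf hp e = G.nodeOf hp f ↔ e = f := by
  refine ⟨fun h1 => ?_, congrArg _⟩
  rw [← G.pow_edgeColour_nodeOf hp e, ← G.pow_edgeColour_nodeOf hp f, h1, h]

theorem exists_nodeOf_eq {p : Perm G.Edge}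
    (hp : ∀ e, G.edgeColour (p e) = G.edgeColour e + 1) (a : G.Node)
    (c : Fin (branchNumber g μ ν + 1)) : ∃ e, G.nodeOf hp e = a ∧ G.edgeColour e = c := by
  have hc : G.edgeColour ((p ^ c.val) a.1) = c := by
    rw [G.edgeColour_pow hp, a.2]
    simp
  refine ⟨(p ^ c.val) a.1, Subtype.ext (((G.nodeOf_val hp _)).trans ?_), hc⟩
  rw [hc, inv_pow, ← Perm.mul_apply, inv_mul_cancel, Perm.one_apply]

theorem nodeOf_apply_of_ne_last {p : Perm G.Edge}
    (hp : ∀ e, G.edgeColour (p e) = G.edgeColour e + 1) {e : G.Edge}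
    (h : G.edgeColour e ≠ Fin.last _) : G.nodeOf hp (p e) = G.nodeOf hp e := by
  refine Subtype.ext ?_
  simp only [nodeOf, hp, Fin.val_add_one_of_lt (Fin.lt_last_iff_ne_last.mpr h)]
  rw [pow_succ, Perm.mul_apply]
  simp

theorem nodeOf_apply_of_eq_last {p : Perm G.Edge}
    (hp : ∀ e, G.edgeColour (p e) = G.edgeColour e + 1) {e : G.Edge}
    (h : G.edgeColour e = Fin.last _) : G.nodeOf hp (p e) = G.nextNode hp (G.nodeOf hp e) := by
  have h1 := G.pow_edgeColour_nodeOf hp e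
  rw [h, Fin.val_last] at h1
  refine Subtype.ext (Eq.trans ?_ (G.nextNode_val hp _).symm)
  rw [pow_succ', Perm.mul_apply, h1]
  simp [nodeOf, hp, h]

end HurwitzGalaxy

/-! ### Corners and the tour around the mobile -/

namespace MarkedHurwitzGalaxy

open BicolouredMap HurwitzGalaxy

section General

variable {g d : ℕ} {μ ν : Composition d} (G : MarkedHurwitzGalaxy.{v} g μ ν)

/-- The corners that follow the edges in their white (left summand) and in their black
(right summand) faces; they correspond to the spots of the mobile. -/
abbrev Corner : Type v := G.Edge ⊕ G.Edge

/-- The edges of the mobile. -/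
abbrev MobileEdge : Type v := {e : G.Edge // ¬ G.IsGeodesic e} ⊕ {x : G.Vertex // G.IsDouble x}

variable {G}

/-- The vertex of the galaxy at which an edge of the mobile is placed. -/
def MobileEdge.vertex : G.MobileEdge → G.Vertex
  | .inl e => G.target e.1
  | .inr x => x.1

/-- The edge of the mobile ends at the corner. -/
def MobileEdge.IsEnd : G.MobileEdge → G.Corner → Prop
  | .inl e, s => s = .inl e.1 ∨ s = .inr e.1
  | .inr x, s => ∃ e, G.target e = x.1 ∧ s = .inl e

theorem MobileEdge.isEnd_inl_iff {z : G.MobileEdge} {e : G.Edge} : z.IsEnd (.inl e) ↔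
    z.vertex = G.target e ∧ ∀ f : {e : G.Edge // ¬ G.IsGeodesic e}, z = .inl f → f.1 = e := by
  rcases z with f | x
  · simp only [IsEnd, vertex, Sum.inl.injEq, reduceCtorEq, or_false, forall_eq']
    exact ⟨by rintro rfl; simp, fun h => h.2.symm⟩
  · simp [IsEnd, vertex, eq_comm]

theorem MobileEdge.isEnd_inr_iff {z : G.MobileEdge} {e : G.Edge} : z.IsEnd (.inr e) ↔
    ∃ h : ¬ G.IsGeodesic e, z = .inl ⟨e, h⟩ := by
  rcases z with f | x
  · simp only [IsEnd, reduceCtorEq, Sum.inr.injEq, false_or, Sum.inl.injEq]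
    exact ⟨by rintro rfl; exact ⟨f.2, rfl⟩, by rintro ⟨h, rfl⟩; rfl⟩
  · simp [IsEnd]

theorem exists_isEnd_inl_iff {e : G.Edge} : (∃ z : G.MobileEdge, z.IsEnd (.inl e)) ↔
    ¬ G.IsGeodesic e ∨ G.IsDouble (G.target e) := by
  constructor
  · rintro ⟨f | x, h⟩
    · have h2 := (MobileEdge.isEnd_inl_iff.mp h).2 f rfl
      exact .inl (h2 ▸ f.2)
    · have h1 := (MobileEdge.isEnd_inl_iff.mp h).1
      exact .inr (h1 ▸ x.2)
  · rintro (h | h)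
    · exact ⟨.inl ⟨e, h⟩, .inl rfl⟩
    · exact ⟨.inr ⟨_, h⟩, e, rfl, rfl⟩

/-- Both incoming edges of a double vertex are geodesic, so an edge of weight 0 and one of positive
weight never share a corner. -/
theorem MobileEdge.eq_of_isEnd {z z' : G.MobileEdge} {s : G.Corner} (h : z.IsEnd s)
    (h' : z'.IsEnd s) : z = z' := by
  rcases s with e | e
  · rw [isEnd_inl_iff] at h h'
    rcases z with ⟨f, hf⟩ | ⟨x, hx⟩ <;> rcases z' with ⟨f', hf'⟩ | ⟨x', hx'⟩
    · have h1 := h.2 _ rfl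
      have h2 := h'.2 _ rfl
      subst h1
      exact congrArg Sum.inl (Subtype.ext h2.symm)
    · have h1 := h.2 _ rfl
      have h2 := h'.1
      simp only [vertex] at h1 h2
      subst h1 h2
      exact absurd (G.isDouble_target_iff.mp hx').2.1 hf
    · have h1 := h'.2 _ rfl
      have h2 := h.1
      simp only [vertex] at h1 h2
      subst h1 h2
      exact absurd (G.isDouble_target_iff.mp hx).2.1 hf'
    · exact congrArg Sum.inr (Subtype.ext (h.1.trans h'.1.symm))
  · obtain ⟨_, rfl⟩ := isEnd_inr_iff.mp h
    obtain ⟨_, rfl⟩ := isEnd_inr_iff.mp h'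
    rfl

variable (G)

/-- The next corner of the same face, counter-clockwise around the mobile. -/
def advance : G.Corner → G.Corner
  | .inl e => .inl (G.white⁻¹ e)
  | .inr e => .inr (G.black e)

open Classical in
/-- Follow the edge of the mobile that ends at a corner. -/
noncomputable def cross : G.Corner → G.Corner
  | .inl e => if G.IsGeodesic e then
      .inl (if G.IsDouble (G.target e) then G.rot e else e) else .inr e
  | .inr e => if G.IsGeodesic e then .inr e else .inl e

/-- The counter-clockwise path around the mobile which starts in the black face of `e`. -/
noncomputable def tour (e : G.Edge) (k : ℕ) : G.Corner := (G.cross ∘ G.advance)^[k] (.inr e)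

variable {G}

theorem tour_zero (e : G.Edge) : G.tour e 0 = .inr e := rfl

theorem tour_succ (e : G.Edge) (k : ℕ) :
    G.tour e (k + 1) = G.cross (G.advance (G.tour e k)) :=
  Function.iterate_succ_apply' _ _ _

theorem MobileEdge.isEnd_cross {z : G.MobileEdge} {s : G.Corner} (h : z.IsEnd s) :
    z.IsEnd (G.cross s) := by
  rcases s with e | e
  · by_cases he : G.IsGeodesic e
    · by_cases hd : G.IsDouble (G.target e)
      · obtain rfl : z = .inr ⟨_, hd⟩ := eq_of_isEnd h ⟨e, rfl, rfl⟩
        rw [cross, if_pos he, if_pos hd]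
        exact ⟨_, target_rot e, rfl⟩
      · rwa [cross, if_pos he, if_neg hd]
    · obtain rfl : z = .inl ⟨_, he⟩ := eq_of_isEnd h (.inl rfl)
      rw [cross, if_neg he]
      exact .inr rfl
  · obtain ⟨he, rfl⟩ := isEnd_inr_iff.mp h
    rw [cross, if_neg he]
    exact .inl rfl

theorem MobileEdge.cross_ne {z : G.MobileEdge} {s : G.Corner} (h : z.IsEnd s) :
    G.cross s ≠ s := by
  rcases s with e | e
  · by_cases he : G.IsGeodesic e
    · have hd := (exists_isEnd_inl_iff.mp ⟨z, h⟩).resolve_left (not_not.mpr he)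
      rw [cross, if_pos he, if_pos hd]
      exact fun h1 => (G.isDouble_target_iff.mp hd).1 (Sum.inl_injective h1)
    · rw [cross, if_neg he]
      exact Sum.inr_ne_inl
  · obtain ⟨he, rfl⟩ := isEnd_inr_iff.mp h
    rw [cross, if_neg he]
    exact Sum.inl_ne_inr

theorem MobileEdge.eq_cross {z : G.MobileEdge} {s t : G.Corner} (h : z.IsEnd s)
    (ht : z.IsEnd t) (hst : t ≠ s) : t = G.cross s := by
  rcases z with ⟨f, hf⟩ | ⟨x, hx⟩
  · rcases h with rfl | rfl <;> rcases ht with rfl | rfl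
    · exact absurd rfl hst
    · rw [cross, if_neg hf]
    · rw [cross, if_neg hf]
    · exact absurd rfl hst
  · obtain ⟨e, rfl, rfl⟩ := h
    obtain ⟨e', h', rfl⟩ := ht
    have h2 := G.isDouble_target_iff.mp hx
    rw [cross, if_pos h2.2.1, if_pos hx]
    rcases G.target_eq_target_iff.mp h' with rfl | rfl
    · exact absurd rfl hst
    · rfl

theorem cross_of_forall_not_isEnd {s : G.Corner} (h : ∀ z : G.MobileEdge, ¬ z.IsEnd s) :
    G.cross s = s := by
  rcases s with e | e
  · have h1 : ¬ ∃ z : G.MobileEdge, z.IsEnd (.inl e) := fun ⟨z, hz⟩ => h z hz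
    rw [exists_isEnd_inl_iff, not_or, not_not] at h1
    rw [cross, if_pos h1.1, if_neg h1.2]
  · have h1 : G.IsGeodesic e := by
      by_contra he
      exact h (.inl ⟨e, he⟩) (.inr rfl)
    rw [cross, if_pos h1]

variable (G)

/-- The colour of the vertex at a corner. -/
def cornerColour : G.Corner → Fin (branchNumber g μ ν + 1) := Sum.elim G.edgeColour G.edgeColour

/-- The label of a corner when the tour leaves it. -/
noncomputable def leaveDist : G.Corner → ℕ
  | .inl e => G.dist (G.source e) + 1
  | .inr e => G.dist (G.target e)

/-- The label of a corner when the tour arrives at it. -/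
noncomputable def arriveDist : G.Corner → ℕ
  | .inl e => G.dist (G.target e)
  | .inr e => G.dist (G.source e) + 1

variable {G}

theorem arriveDist_advance_inl (e : G.Edge) :
    G.arriveDist (G.advance (.inl e)) + 1 = G.leaveDist (.inl e) := rfl

theorem arriveDist_advance_inr (e : G.Edge) :
    G.arriveDist (G.advance (.inr e)) = G.leaveDist (.inr e) + 1 := by
  rw [advance, arriveDist, leaveDist, source_black]

/-- The two labels of a corner agree when its edge is geodesic, and the two geodesic edges into a
double vertex start at equal distances. At a non-geodesic edge the labels differ, but the arrival
label on one side is the leaving label on the other. -/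
theorem leaveDist_cross (s : G.Corner) : G.leaveDist (G.cross s) = G.arriveDist s := by
  rcases s with e | e
  · by_cases he : G.IsGeodesic e
    · by_cases hd : G.IsDouble (G.target e)
      · rw [cross, if_pos he, if_pos hd, arriveDist, leaveDist,
          ← (G.isGeodesic_iff _).mp (G.isDouble_target_iff.mp hd).2.2, target_rot]
      · rw [cross, if_pos he, if_neg hd, arriveDist, leaveDist, (G.isGeodesic_iff _).mp he]
    · rw [cross, if_neg he, arriveDist, leaveDist]
  · by_cases he : G.IsGeodesic e
    · rw [cross, if_pos he, arriveDist, leaveDist, (G.isGeodesic_iff _).mp he]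
    · rw [cross, if_neg he, arriveDist, leaveDist]

theorem cornerColour_cross (s : G.Corner) : G.cornerColour (G.cross s) = G.cornerColour s := by
  rcases s with e | e
  · by_cases he : G.IsGeodesic e
    · by_cases hd : G.IsDouble (G.target e)
      · rw [cross, if_pos he, if_pos hd]
        exact G.edgeColour_rot e
      · rw [cross, if_pos he, if_neg hd]
    · rw [cross, if_neg he]
      rfl
  · by_cases he : G.IsGeodesic e
    · rw [cross, if_pos he]
    · rw [cross, if_neg he]
      rfl

end General

section Simple

variable {g d : ℕ} {μ : Composition d} {G : MarkedHurwitzGalaxy.{v} g μ (Composition.ones d)}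

theorem tour_eq_inr {e : G.Edge} (he : ¬ G.IsGeodesic e) {k : ℕ}
    (hk : k ≤ branchNumber g μ (Composition.ones d)) :
    G.tour e k = .inr ((G.black ^ k) e) := by
  induction k with
  | zero => rfl
  | succ k ih =>
    rw [tour_succ, ih (by omega), advance, ← Perm.mul_apply, ← pow_succ', cross,
      if_pos (isGeodesic_black_pow he (by omega) hk)]

theorem advance_tour_branchNumber {e : G.Edge} (he : ¬ G.IsGeodesic e) :
    G.advance (G.tour e (branchNumber g μ (Composition.ones d))) = .inr e := by
  rw [tour_eq_inr he le_rfl, advance, ← Perm.mul_apply, ← pow_succ', G.black_pow_branchNumber]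

theorem tour_branchNumber_add_one {e : G.Edge} (he : ¬ G.IsGeodesic e) :
    G.tour e (branchNumber g μ (Composition.ones d) + 1) = .inl e := by
  rw [tour_succ, advance_tour_branchNumber he, cross, if_neg he]

theorem tour_add {e f : G.Edge} {k : ℕ} (h : G.tour e k = .inr f) (n : ℕ) :
    G.tour e (n + k) = G.tour f n := by
  rw [tour, Function.iterate_add_apply]
  exact congrArg _ h

/-- The tour enters the black faces along the edges of the mobile that end there. -/
theorem exists_advance_tour_eq_inl {e f : G.Edge} {k : ℕ} (h : G.tour e k = .inr f) :
    G.blackFace f = G.blackFace e ∨ ∃ j < k, ∃ f', ¬ G.IsGeodesic f' ∧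
      G.blackFace f' = G.blackFace f ∧ G.advance (G.tour e j) = .inl f' := by
  induction k generalizing f with
  | zero => exact .inl (by rw [Sum.inr_injective h])
  | succ k ih =>
    rw [tour_succ] at h
    rcases hs : G.tour e k with f' | f'
    · rw [hs, advance] at h
      by_cases hf : G.IsGeodesic (G.white⁻¹ f')
      · rw [cross, if_pos hf] at h
        exact absurd h Sum.inl_ne_inr
      · rw [cross, if_neg hf] at h
        obtain rfl := Sum.inr_injective h
        exact .inr ⟨k, k.lt_succ_self, _, hf, rfl, by rw [hs, advance]⟩
    · rw [hs, advance] at h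
      by_cases hf : G.IsGeodesic (G.black f')
      · rw [cross, if_pos hf] at h
        obtain rfl := Sum.inr_injective h
        simp only [blackFace_black]
        rcases ih hs with h1 | ⟨j, hj, h1⟩
        · exact .inl h1
        · exact .inr ⟨j, hj.trans k.lt_succ_self, h1⟩
      · rw [cross, if_neg hf] at h
        exact absurd h Sum.inl_ne_inr

/-- An edge of the mobile other than the first one is first reached at a white polygon. -/
theorem exists_advance_tour_eq_inl_of_isEnd {e : G.Edge} (he : ¬ G.IsGeodesic e)
    {z : G.MobileEdge} (hz : z ≠ .inl ⟨e, he⟩) {k : ℕ} (hk : z.IsEnd (G.advance (G.tour e k)))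
    (hmin : ∀ j < k, ¬ z.IsEnd (G.advance (G.tour e j))) :
    ∃ f, G.advance (G.tour e k) = .inl f := by
  rcases hs : G.tour e k with f | f
  · exact ⟨_, rfl⟩
  · rw [hs, advance] at hk
    obtain ⟨hf, rfl⟩ := MobileEdge.isEnd_inr_iff.mp hk
    exfalso
    rcases exists_advance_tour_eq_inl hs with h | ⟨j, hj, f', hf', h1, h2⟩
    · exact hz (congrArg Sum.inl (Subtype.ext
        (eq_of_not_isGeodesic hf he (by rw [blackFace_black, h]))))
    · refine hmin j hj ?_
      rw [h2, eq_of_not_isGeodesic hf' hf (by rw [blackFace_black, h1])]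
      exact .inl rfl

-- A detour into a black face lasts `b + 1` further steps and ends at the white corner from which it
-- entered. Apart from detours the tour applies a permutation of the white corners.
open Classical in
theorem exists_tour_eq_inl_of_tour_eq_inl {e f : G.Edge} {k : ℕ} (h : G.tour e k = .inl f) :
    ∃ n, G.tour e n = .inl (if G.IsDouble (G.target (G.white⁻¹ f)) then
      G.rot (G.white⁻¹ f) else G.white⁻¹ f) := by
  by_cases hf : G.IsGeodesic (G.white⁻¹ f)
  · exact ⟨k + 1, by rw [tour_succ, h, advance, cross, if_pos hf]⟩
  · rw [if_neg fun h1 => hf (G.isDouble_target_iff.mp h1).2.1]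
    have h1 : G.tour e (k + 1) = .inr (G.white⁻¹ f) := by
      rw [tour_succ, h, advance, cross, if_neg hf]
    exact ⟨_, (tour_add h1 _).trans (tour_branchNumber_add_one hf)⟩

end Simple

end MarkedHurwitzGalaxy

/-! ### The tour visits every white corner -/

namespace HurwitzGalaxy

variable {g d : ℕ} {μ ν : Composition d} (G : HurwitzGalaxy.{v} g μ ν)

theorem card_cycles_white :
    Nat.card (Quotient (Perm.SameCycle.setoid G.white)) = μ.length := by
  let f : Quotient (Perm.SameCycle.setoid G.white) → Fin μ.length :=
    Quotient.lift G.whiteFace fun e f h => (G.whiteFace_eq_iff e f).mpr h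
  have hf : Function.Bijective f := by
    refine ⟨fun c c' h => ?_, fun i => ?_⟩
    · induction c using Quotient.inductionOn
      induction c' using Quotient.inductionOn
      exact Quotient.sound ((G.whiteFace_eq_iff _ _).mp h)
    · obtain ⟨e, he⟩ := G.whiteFace_surjective i
      exact ⟨Quotient.mk _ e, he⟩
  rw [Nat.card_congr (Equiv.ofBijective f hf), Nat.card_fin]

end HurwitzGalaxy

namespace MarkedHurwitzGalaxy

open BicolouredMap HurwitzGalaxy

theorem card_not_isGeodesic {g d : ℕ} {μ : Composition d}
    (G : MarkedHurwitzGalaxy.{v} g μ (Composition.ones d)) :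
    Nat.card {e // ¬ G.IsGeodesic e} = d := by
  have hf : Function.Bijective fun e : {e // ¬ G.IsGeodesic e} => G.blackFace e.1 := by
    refine ⟨fun e f h => Subtype.ext (eq_of_not_isGeodesic e.2 f.2 h), fun j => ?_⟩
    obtain ⟨e, he, he'⟩ := G.exists_not_isGeodesic j
    exact ⟨⟨e, he'⟩, he⟩
  rw [Nat.card_congr (Equiv.ofBijective _ hf), Nat.card_fin, Composition.ones_length]

variable {d : ℕ} {μ : Composition d} {G : MarkedHurwitzGalaxy.{v} 0 μ (Composition.ones d)}

/-- Of the `b + 1 = ℓ + d - 1` edges of the mobile, `d` have positive weight. Since `2 ≤ d`, the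
truncated subtraction in `branchNumber` is exact. -/
theorem card_isDouble_add_one (hd : 2 ≤ d) (M : HurwitzMobile.{u} μ (Composition.ones d))
    (φ : M.toMobileGraph.Iso G.mobile) : Nat.card {x // G.IsDouble x} + 1 = μ.length := by
  have := G.finite_edge
  have : Finite G.Vertex := Quotient.finite _
  have h1 : Nat.card M.Edge = Nat.card ({e // ¬ G.IsGeodesic e} ⊕ {x // G.IsDouble x}) :=
    Nat.card_congr φ.edge
  rw [M.card_edge, Nat.card_sum, card_not_isGeodesic, branchNumber, Composition.ones_length] at h1
  omega

/-- This carries the connectedness of the mobile over to the galaxy. Black polygons are leaves, so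
the white polygons must be connected through the edges of weight 0 alone. -/
theorem rel_of_rel_white_of_rel_rot (M : HurwitzMobile.{u} μ (Composition.ones d))
    (φ : M.toMobileGraph.Iso G.mobile) (r : Setoid G.Edge) (hw : ∀ e, r e (G.white e))
    (hr : ∀ e, G.IsDouble (G.target e) → r e (G.rot e)) (e f : G.Edge) : r e f := by
  have hpow : ∀ (n : ℕ) (e : G.Edge), r e ((G.white ^ n) e) := fun n e =>
    Perm.SameCycle.rel_of_forall_rel hw ⟨n, by simp⟩
  have hnode : ∀ e, r e (G.nodeOf G.edgeColour_white e).1 := fun e =>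
    Perm.SameCycle.rel_of_forall_rel hw
      (Perm.SameCycle.symm ⟨(G.edgeColour e).val, G.pow_edgeColour_nodeOf G.edgeColour_white e⟩)
  choose y hy hy' using G.exists_not_isGeodesic
  have hy_eq : ∀ e, ¬ G.IsGeodesic e → y (G.blackFace e) = e := fun e he =>
    eq_of_not_isGeodesic (hy' _) he (hy _)
  -- A black polygon gets the class of the white face across its only non-geodesic edge; then `c` is
  -- constant along arcs and mobile edges.
  let c : M.WhiteNode ⊕ M.BlackNode → Quotient r :=
    Sum.elim (fun x => Quotient.mk r (φ.whiteNode x).1)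
      (fun p => Quotient.mk r (y (G.blackFace (φ.blackNode p).1)))
  have hinc : ∀ z s t, M.Inc z s → M.Inc z t → c s = c t := by
    intro z s t hs ht
    rw [← φ.inc] at hs ht
    have key : ∃ q, ∀ s, G.mobile.Inc (φ.edge z) (Sum.map φ.whiteNode φ.blackNode s) →
        c s = q := by
      generalize φ.edge z = w
      rcases w with w | w
      · refine ⟨Quotient.mk r w.1, ?_⟩
        rintro (x | p) (h | h)
        · refine Quotient.sound (r.symm ?_)
          rw [Sum.inl_injective h]
          exact hnode w.1
        · exact absurd h Sum.inl_ne_inr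
        · exact absurd h Sum.inr_ne_inl
        · have h2 : G.blackFace (φ.blackNode p).1 = G.blackFace w.1 := by
            rw [Sum.inr_injective h]
            refine (G.blackFace_eq_iff _ _).mpr
              ⟨(G.edgeColour w.1).val, G.pow_edgeColour_nodeOf G.edgeColour_black w.1⟩
          change Quotient.mk r (y (G.blackFace (φ.blackNode p).1)) = _
          rw [h2, hy_eq _ w.2]
      · obtain ⟨e, he⟩ := exists_target_eq w.1
        refine ⟨Quotient.mk r e, ?_⟩
        rintro (x | p) ⟨e', he', h⟩
        · refine Quotient.sound (r.symm ?_)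
          rw [Sum.inl_injective h]
          refine r.trans ?_ (hnode e')
          have hdbl : G.IsDouble (G.target e) := he ▸ w.2
          rcases G.target_eq_target_iff.mp (he'.trans he.symm) with rfl | rfl
          · exact r.refl _
          · exact hr e hdbl
        · exact absurd h Sum.inr_ne_inl
    obtain ⟨q, hq⟩ := key
    rw [hq s hs, hq t ht]
  have hjoin : ∀ s t, M.Joined s t → c s = c t := by
    rintro s t (x | p | ⟨z, hs, ht⟩)
    · refine Quotient.sound ?_
      rw [φ.nextWhite]
      exact hpow _ _
    · simp only [c, Sum.elim_inr]
      rw [φ.nextBlack]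
      congr 2
      exact (G.blackFace_black_pow _ _).symm
    · exact hinc z s t hs ht
  have hall : ∀ s t, c s = c t := fun s t => by
    induction M.connected s t with
    | rel s t h => exact hjoin s t h
    | refl s => rfl
    | symm s t _ h => exact h.symm
    | trans s t u _ _ h1 h2 => exact h1.trans h2
  obtain ⟨x, hx⟩ := φ.whiteNode.surjective (G.nodeOf G.edgeColour_white e)
  obtain ⟨x', hx'⟩ := φ.whiteNode.surjective (G.nodeOf G.edgeColour_white f)
  have h : r (φ.whiteNode x).1 (φ.whiteNode x').1 := Quotient.exact (hall (.inl x) (.inl x'))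
  have h1 : (φ.whiteNode x).1 = _ := congrArg Subtype.val hx
  have h2 : (φ.whiteNode x').1 = _ := congrArg Subtype.val hx'
  rw [h1, h2] at h
  exact r.trans (hnode e) (r.trans h (r.symm (hnode f)))

-- There are `ℓ` white cycles, connected by one transposition for each of the `ℓ - 1` double
-- vertices. This is the equality case of `card_cycles_le_and_sameCycle_mul_prod`, so their product
-- is a single cycle.
open Classical in
theorem exists_perm_sameCycle (hd : 2 ≤ d) (M : HurwitzMobile.{u} μ (Composition.ones d))
    (φ : M.toMobileGraph.Iso G.mobile) : ∃ ρ : Perm G.Edge,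
      (∀ e, ρ e = G.white (if G.IsDouble (G.target e) then G.rot e else e)) ∧
        ∀ e f, ρ.SameCycle e f := by
  have := G.finite_edge
  have : Finite G.Vertex := Quotient.finite _
  have := Fintype.ofFinite {x // G.IsDouble x}
  choose y hy using fun x : {x // G.IsDouble x} => exists_target_eq x.1
  have hyinj : Function.Injective y := fun x x' h => Subtype.ext (by rw [← hy, ← hy, h])
  let l : List G.Edge := (Finset.univ : Finset {x // G.IsDouble x}).toList.map y
  have hmem : ∀ e, e ∈ l ↔ ∃ x, y x = e := by simp [l]
  have hl : l.Nodup := (Finset.nodup_toList _).map hyinj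
  have hl' : ∀ e ∈ l, G.rot e ∉ l := by
    intro e he he'
    obtain ⟨x, rfl⟩ := (hmem _).mp he
    obtain ⟨x', hx'⟩ := (hmem _).mp he'
    have h1 : x' = x := Subtype.ext (by rw [← hy, hx', target_rot, hy])
    have h2 : G.IsDouble (G.target (y x)) := by rw [hy]; exact x.2
    exact (G.isDouble_target_iff.mp h2).1 (by rw [← hx', h1])
  have hdouble : ∀ e, G.IsDouble (G.target e) ↔ e ∈ l ∨ G.rot e ∈ l := by
    intro e
    constructor
    · intro h
      rcases G.target_eq_target_iff.mp (hy ⟨_, h⟩) with h1 | h1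
      · exact .inl ((hmem _).mpr ⟨_, h1⟩)
      · exact .inr ((hmem _).mpr ⟨_, h1⟩)
    · rintro (h | h)
      · obtain ⟨x, rfl⟩ := (hmem _).mp h
        rw [hy]
        exact x.2
      · obtain ⟨x, hx⟩ := (hmem _).mp h
        rw [← target_rot, ← hx, hy]
        exact x.2
  have h := (Perm.card_cycles_le_and_sameCycle_mul_prod (l.map fun e => (e, G.rot e)) G.white
    fun r hw hr => rel_of_rel_white_of_rel_rot M φ r hw fun e he => by
      rcases (hdouble e).mp he with h | h
      · exact hr (e, G.rot e) (List.mem_map_of_mem h)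
      · refine r.symm ?_
        have := hr (G.rot e, G.rot (G.rot e)) (List.mem_map_of_mem h)
        rwa [G.rot_rot] at this).2 (by
          rw [G.card_cycles_white, ← card_isDouble_add_one hd M φ]
          simp [l, Nat.card_eq_fintype_card])
  refine ⟨_, fun e => ?_, h⟩
  rw [List.map_map, Perm.mul_apply]
  congr 1
  refine (Perm.prod_map_swap_apply G.rot_rot hl hl' e).trans ?_
  simp only [hdouble]

/-- The tour around the mobile visits all white corners. -/
theorem exists_tour_eq_inl (hd : 2 ≤ d) (M : HurwitzMobile.{u} μ (Composition.ones d))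
    (φ : M.toMobileGraph.Iso G.mobile) {e : G.Edge} (he : ¬ G.IsGeodesic e) (f : G.Edge) :
    ∃ k, G.tour e k = .inl f := by
  classical
  have := G.finite_edge
  obtain ⟨ρ, hρ, hcycle⟩ := exists_perm_sameCycle hd M φ
  have hinv : ∀ f, ρ⁻¹ f = if G.IsDouble (G.target (G.white⁻¹ f)) then
      G.rot (G.white⁻¹ f) else G.white⁻¹ f := by
    intro f
    rw [Perm.inv_eq_iff_eq, hρ]
    by_cases h : G.IsDouble (G.target (G.white⁻¹ f))
    · simp only [h, if_true, target_rot, G.rot_rot]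
      simp
    · simp only [h, if_false]
      simp
  obtain ⟨n, -, hn⟩ := (Perm.sameCycle_inv.mpr (hcycle e f)).exists_pow_eq'
  have key : ∀ n, ∃ k, G.tour e k = .inl ((ρ⁻¹ ^ n) e) := by
    intro n
    induction n with
    | zero => exact ⟨_, tour_branchNumber_add_one he⟩
    | succ n ih =>
      obtain ⟨k, hk⟩ := ih
      rw [pow_succ', Perm.mul_apply, hinv]
      exact exists_tour_eq_inl_of_tour_eq_inl hk
  rw [← hn]
  exact key n

theorem exists_isEnd_advance_tour (hd : 2 ≤ d) (M : HurwitzMobile.{u} μ (Composition.ones d))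
    (φ : M.toMobileGraph.Iso G.mobile) {e : G.Edge} (he : ¬ G.IsGeodesic e) (z : G.MobileEdge) :
    ∃ k, z.IsEnd (G.advance (G.tour e k)) := by
  obtain ⟨f, hf⟩ : ∃ f, z.IsEnd (.inl f) := by
    rcases z with f | x
    · exact ⟨f.1, .inl rfl⟩
    · obtain ⟨f, hf⟩ := exists_target_eq x.1
      exact ⟨f, f, hf, rfl⟩
  -- The corner reached by `advance` from `white f` is that of `f`.
  obtain ⟨k, hk⟩ := exists_tour_eq_inl hd M φ he (G.white f)
  refine ⟨k, ?_⟩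
  rw [hk, advance]
  simpa using hf

/-! ### Transfer of the contour to an isomorphic mobile -/

section General

variable {g d : ℕ} {μ ν : Composition d} {G : MarkedHurwitzGalaxy.{v} g μ ν}
  {M : MobileGraph.{u} (branchNumber g μ ν) μ.length ν.length} (φ : M.Iso G.mobile)

/-- The edge of the mobile of the galaxy which corresponds to an edge of an isomorphic mobile. -/
def mobileEdge : M.Edge ≃ G.MobileEdge := φ.edge

/-- The node of the galaxy which corresponds to a white node of an isomorphic mobile. -/
def whiteNode : M.WhiteNode ≃ G.Node := φ.whiteNode

/-- The node of the galaxy which corresponds to a black node of an isomorphic mobile. -/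
def blackNode : M.BlackNode ≃ G.Node := φ.blackNode

theorem whiteNode_nextWhite (x : M.WhiteNode) :
    whiteNode φ (M.nextWhite x) = G.nextNode G.edgeColour_white (whiteNode φ x) :=
  φ.nextWhite x

theorem blackNode_nextBlack (p : M.BlackNode) :
    blackNode φ (M.nextBlack p) = G.nextNode G.edgeColour_black (blackNode φ p) :=
  φ.nextBlack p

theorem inc_inl_iff {z : M.Edge} {x : M.WhiteNode} :
    M.Inc z (.inl x) ↔ G.mobile.Inc (mobileEdge φ z) (.inl (whiteNode φ x)) :=
  (φ.inc z (.inl x)).symm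

theorem inc_inr_iff {z : M.Edge} {p : M.BlackNode} :
    M.Inc z (.inr p) ↔ G.mobile.Inc (mobileEdge φ z) (.inr (blackNode φ p)) :=
  (φ.inc z (.inr p)).symm

/-- The spot of the mobile at a corner of the galaxy. -/
def spot : G.Corner → M.Spot
  | .inl e => (.inl ((whiteNode φ).symm (G.nodeOf G.edgeColour_white e)), G.edgeColour e)
  | .inr e => (.inr ((blackNode φ).symm (G.nodeOf G.edgeColour_black e)), G.edgeColour e)

theorem spot_injective : Function.Injective (spot φ) := by
  rintro (e | e) (f | f) h
  · have h1 := (whiteNode φ).symm.injective (Sum.inl_injective (congrArg Prod.fst h))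
    rw [(nodeOf_eq_nodeOf_iff _ (congrArg Prod.snd h)).mp h1]
  · exact absurd (congrArg Prod.fst h) Sum.inl_ne_inr
  · exact absurd (congrArg Prod.fst h) Sum.inr_ne_inl
  · have h1 := (blackNode φ).symm.injective (Sum.inr_injective (congrArg Prod.fst h))
    rw [(nodeOf_eq_nodeOf_iff _ (congrArg Prod.snd h)).mp h1]

theorem spot_surjective : Function.Surjective (spot φ) := by
  rintro ⟨x | p, c⟩
  · obtain ⟨e, he, rfl⟩ := exists_nodeOf_eq G.edgeColour_white (whiteNode φ x) c
    exact ⟨.inl e, by rw [spot, he, Equiv.symm_apply_apply]⟩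
  · obtain ⟨e, he, rfl⟩ := exists_nodeOf_eq G.edgeColour_black (blackNode φ p) c
    exact ⟨.inr e, by rw [spot, he, Equiv.symm_apply_apply]⟩

theorem label_eq_colour (z : M.Edge) : M.label z = G.colour (mobileEdge φ z).vertex := by
  rw [← φ.label]
  change G.mobile.label (mobileEdge φ z) = _
  rcases mobileEdge φ z with f | x <;> rfl

theorem isEnd_spot_iff {z : M.Edge} {s : G.Corner} :
    M.IsEnd z (spot φ s) ↔ (mobileEdge φ z).IsEnd s := by
  rw [MobileGraph.IsEnd, label_eq_colour φ]
  rcases s with e | e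
  · rw [spot, inc_inl_iff φ, Equiv.apply_symm_apply]
    rcases mobileEdge φ z with f | x
    · constructor
      · rintro ⟨h1, h2 | h2⟩
        · exact .inl (congrArg Sum.inl
            ((nodeOf_eq_nodeOf_iff G.edgeColour_white h1.symm).mp (Sum.inl_injective h2)))
        · exact absurd h2 Sum.inl_ne_inr
      · rintro (h | h)
        · obtain rfl := Sum.inl_injective h
          exact ⟨rfl, .inl rfl⟩
        · exact absurd h Sum.inl_ne_inr
    · constructor
      · rintro ⟨h1, e', h2, h3⟩
        refine ⟨e', h2, congrArg Sum.inl
          ((nodeOf_eq_nodeOf_iff G.edgeColour_white ?_).mp (Sum.inl_injective h3))⟩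
        rw [edgeColour, edgeColour, h2]
        exact h1.symm
      · rintro ⟨e', h2, h3⟩
        obtain rfl := Sum.inl_injective h3
        exact ⟨congrArg G.colour h2.symm, e, h2, rfl⟩
  · rw [spot, inc_inr_iff φ, Equiv.apply_symm_apply]
    rcases mobileEdge φ z with f | x
    · constructor
      · rintro ⟨h1, h2 | h2⟩
        · exact absurd h2 Sum.inr_ne_inl
        · exact .inr (congrArg Sum.inr
            ((nodeOf_eq_nodeOf_iff G.edgeColour_black h1.symm).mp (Sum.inr_injective h2)))
      · rintro (h | h)
        · exact absurd h Sum.inr_ne_inl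
        · obtain rfl := Sum.inr_injective h
          exact ⟨rfl, .inr rfl⟩
    · constructor
      · rintro ⟨h1, e', h2, h3⟩
        exact absurd h3 Sum.inr_ne_inl
      · rintro ⟨e', h2, h3⟩
        exact absurd h3 Sum.inr_ne_inl

theorem edgeColour_apply_eq_zero_iff {e : G.Edge} {p : Perm G.Edge}
    (hp : ∀ e, G.edgeColour (p e) = G.edgeColour e + 1) :
    G.edgeColour (p e) = 0 ↔ G.edgeColour e = Fin.last _ := by
  rw [hp, ← Fin.last_add_one, add_left_inj]

theorem advance_spot (s : G.Corner) : M.advance (spot φ s) = spot φ (G.advance s) := by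
  rcases s with e | e
  · obtain ⟨e, rfl⟩ := G.white.surjective e
    have h0 := edgeColour_apply_eq_zero_iff (e := e) G.edgeColour_white
    rw [advance, Perm.inv_def, Equiv.symm_apply_apply, spot, spot, MobileGraph.advance]
    refine Prod.ext (congrArg Sum.inl ?_) (by simp [G.edgeColour_white])
    by_cases h : G.edgeColour e = Fin.last _
    · rw [if_pos (h0.mpr h), Equiv.symm_apply_eq, nodeOf_apply_of_eq_last _ h,
        Equiv.symm_apply_eq, whiteNode_nextWhite, Equiv.apply_symm_apply]
    · rw [if_neg (mt h0.mp h), nodeOf_apply_of_ne_last _ h]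
  · rw [advance, spot, spot, MobileGraph.advance]
    refine Prod.ext (congrArg Sum.inr ?_) (G.edgeColour_black e).symm
    by_cases h : G.edgeColour e = Fin.last _
    · rw [if_pos h, nodeOf_apply_of_eq_last _ h, Equiv.eq_symm_apply, blackNode_nextBlack,
        Equiv.apply_symm_apply]
    · rw [if_neg h, nodeOf_apply_of_ne_last _ h]

/-- The choice in `MobileGraph.cross` is forced: at most one mobile edge ends at a corner, and it
has only one other end. -/
theorem cross_spot (s : G.Corner) : M.cross (spot φ s) = spot φ (G.cross s) := by
  unfold MobileGraph.cross
  split_ifs with h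
  · obtain ⟨hne, z, hz, hz'⟩ := h.choose_spec
    obtain ⟨t, ht⟩ := spot_surjective φ h.choose
    rw [← ht] at hne hz' ⊢
    rw [isEnd_spot_iff] at hz hz'
    rw [MobileEdge.eq_cross hz hz' fun h' => hne (by rw [h'])]
  · rw [cross_of_forall_not_isEnd fun z hz => h ?_]
    obtain ⟨y, rfl⟩ := (mobileEdge φ).surjective z
    exact ⟨_, fun h' => MobileEdge.cross_ne hz (spot_injective φ h'), y,
      (isEnd_spot_iff φ).mpr hz, (isEnd_spot_iff φ).mpr (MobileEdge.isEnd_cross hz)⟩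

theorem iterate_step_spot (k : ℕ) (s : G.Corner) :
    M.step^[k] (spot φ s) = spot φ ((G.cross ∘ G.advance)^[k] s) := by
  have h : Function.Semiconj (spot φ) (G.cross ∘ G.advance) M.step := fun s => by
    rw [MobileGraph.step, advance_spot, cross_spot, Function.comp_apply]
  exact ((h.iterate_right k).eq s).symm

/-- Distance label and colour change together by `+1` in black faces and `-1` in white ones, except
where the colour wraps around. There an arc is traversed and the difference jumps by `b + 1`. -/
theorem arriveDist_advance_sub_cornerColour (s : G.Corner) :
    (G.arriveDist (G.advance s) : ℤ) - (G.cornerColour (G.advance s)).val =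
      G.leaveDist s - (G.cornerColour s).val + (branchNumber g μ ν + 1) *
        ((M.blackArc (spot φ s) : ℤ) - M.whiteArc (spot φ s)) := by
  rcases s with e | e
  · obtain ⟨e, rfl⟩ := G.white.surjective e
    have h0 := edgeColour_apply_eq_zero_iff (e := e) G.edgeColour_white
    have h1 := arriveDist_advance_inl (G.white e)
    have h2 := Fin.val_add_one (G.edgeColour e)
    rw [← G.edgeColour_white] at h2
    rw [spot, MobileGraph.blackArc, MobileGraph.whiteArc, ← h1]
    simp only [advance, cornerColour, Sum.elim_inl, Perm.inv_def, Equiv.symm_apply_apply]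
    rw [h2]
    by_cases h : G.edgeColour e = Fin.last _
    · rw [if_pos h, if_pos (h0.mpr h), h]
      simp
      ring
    · rw [if_neg h, if_neg (mt h0.mp h)]
      push_cast
      ring
  · have h1 := arriveDist_advance_inr e
    have h2 := Fin.val_add_one (G.edgeColour e)
    rw [← G.edgeColour_black] at h2
    rw [spot, MobileGraph.blackArc, MobileGraph.whiteArc, h1]
    simp only [advance, cornerColour, Sum.elim_inr]
    rw [h2]
    by_cases h : G.edgeColour e = Fin.last _
    · rw [if_pos h, if_pos h, h]
      simp
      ring
    · rw [if_neg h, if_neg h]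
      push_cast
      ring

theorem arriveDist_advance_tour_sub_cornerColour (e : G.Edge) (n : ℕ) :
    (G.arriveDist (G.advance (G.tour e n)) : ℤ) - (G.cornerColour (G.advance (G.tour e n))).val =
      G.dist (G.target e) - (G.edgeColour e).val + (branchNumber g μ ν + 1) *
        ∑ k ∈ Finset.range (n + 1), ((M.blackArc (spot φ (G.tour e k)) : ℤ) -
          M.whiteArc (spot φ (G.tour e k))) := by
  have h := arriveDist_advance_sub_cornerColour φ (G.tour e n)
  rw [h, Finset.sum_range_succ, mul_add, ← add_assoc, add_left_inj]
  clear h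
  induction n with
  | zero => simp [tour_zero, leaveDist, cornerColour]
  | succ n ih =>
    rw [tour_succ, leaveDist_cross, cornerColour_cross,
      arriveDist_advance_sub_cornerColour φ, ih, Finset.sum_range_succ]
    ring

variable {φ}

theorem path_eq {p : M.BlackNode} {y : M.Edge} {e : {e // ¬ G.IsGeodesic e}}
    (hy : mobileEdge φ y = .inl e) (hp : M.Inc y (.inr p)) (k : ℕ) :
    M.path p y k = spot φ (G.tour e.1 k) := by
  have h : spot φ (.inr e.1) = (.inr p, M.label y) := by
    rw [inc_inr_iff φ, hy] at hp
    have h1 : blackNode φ p = G.nodeOf G.edgeColour_black e.1 :=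
      hp.elim (fun h => absurd h Sum.inr_ne_inl) fun h => Sum.inr_injective h
    rw [spot, ← h1, Equiv.symm_apply_apply, label_eq_colour φ, hy]
    rfl
  rw [MobileGraph.path, ← h, iterate_step_spot, tour]

theorem reachesAt_iff {p : M.BlackNode} {y z : M.Edge} {e : {e // ¬ G.IsGeodesic e}}
    (hy : mobileEdge φ y = .inl e) (hp : M.Inc y (.inr p)) {k : ℕ} :
    M.ReachesAt p y z k ↔ (mobileEdge φ z).IsEnd (G.advance (G.tour e.1 k)) := by
  rw [MobileGraph.ReachesAt, path_eq hy hp, advance_spot, isEnd_spot_iff]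

end General

/-! ### Interruption as a comparison of distances -/

section Simple

/-- The colours differ by at most `b`, so they matter only when the arc numbers are equal. -/
theorem lt_or_eq_and_lt_iff {b m n i j k l : ℕ} (hk : k < b + 1) (hl : l < b + 1)
    (h : (j : ℤ) - l = i - k + (b + 1) * ((n : ℤ) - m)) : m < n ∨ m = n ∧ k < l ↔ i < j := by
  rcases lt_trichotomy m n with hmn | rfl | hmn
  · have : (b + 1 : ℤ) * 1 ≤ (b + 1) * ((n : ℤ) - m) :=
      mul_le_mul_of_nonneg_left (by omega) (by omega)
    omega
  · rw [sub_self, mul_zero] at h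
    omega
  · have : (b + 1 : ℤ) * 1 ≤ (b + 1) * ((m : ℤ) - n) :=
      mul_le_mul_of_nonneg_left (by omega) (by omega)
    have h3 : (b + 1 : ℤ) * ((m : ℤ) - n) = - ((b + 1) * ((n : ℤ) - m)) := by ring
    omega

variable {g d : ℕ} {μ : Composition d} {G : MarkedHurwitzGalaxy.{v} g μ (Composition.ones d)}
  {M : MobileGraph.{u} (branchNumber g μ (Composition.ones d)) μ.length
    (Composition.ones d).length} {φ : M.Iso G.mobile}

theorem isWeightOneEdge_iff {P : Fin (Composition.ones d).length} {p : M.BlackNode} {y : M.Edge} :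
    M.IsWeightOneEdge P p y ↔ M.Inc y (.inr p) ∧
      ∃ e : {e // ¬ G.IsGeodesic e}, mobileEdge φ y = .inl e ∧ G.blackFace e.1 = P := by
  have hP : M.blackPolygon p = G.blackFace (blackNode φ p).1 := (φ.blackPolygon p).symm
  have hw : M.weight y = G.mobile.weight (mobileEdge φ y) := (φ.weight y).symm
  have key : ∀ e : {e // ¬ G.IsGeodesic e}, mobileEdge φ y = .inl e → M.Inc y (.inr p) →
      M.blackPolygon p = G.blackFace e.1 := by
    intro e he hp
    rw [inc_inr_iff φ, he] at hp
    have h1 : blackNode φ p = G.nodeOf G.edgeColour_black e.1 :=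
      hp.elim (fun h => absurd h Sum.inr_ne_inl) fun h => Sum.inr_injective h
    rw [hP, h1]
    exact (G.blackFace_eq_iff _ _).mpr
      ⟨(G.edgeColour e.1).val, G.pow_edgeColour_nodeOf G.edgeColour_black e.1⟩
  constructor
  · rintro ⟨h1, h2, h3⟩
    refine ⟨h2, ?_⟩
    rcases hy : mobileEdge φ y with e | x
    · exact ⟨e, rfl, by rw [← h1, key e hy h2]⟩
    · rw [hw, hy] at h3
      exact absurd h3 zero_ne_one
  · rintro ⟨h2, e, hy, h3⟩
    refine ⟨by rw [key e hy h2, h3], h2, ?_⟩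
    rw [hw, hy]
    exact weight_eq_one e.2

theorem exists_isWeightOneEdge (e : {e // ¬ G.IsGeodesic e}) :
    ∃ p y, mobileEdge φ y = .inl e ∧ M.Inc y (.inr p) := by
  obtain ⟨y, hy⟩ := (mobileEdge φ).surjective (.inl e)
  refine ⟨(blackNode φ).symm (G.nodeOf G.edgeColour_black e.1), y, hy, ?_⟩
  rw [inc_inr_iff φ, Equiv.apply_symm_apply, hy]
  exact .inr rfl

theorem isInterrupted_iff {p : M.BlackNode} {y z : M.Edge} {e : {e // ¬ G.IsGeodesic e}}
    (hy : mobileEdge φ y = .inl e) (hp : M.Inc y (.inr p)) (hz : z ≠ y)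
    (hreach : ∃ k, M.ReachesAt p y z k) :
    M.IsInterrupted p y z ↔ G.dist (G.target e.1) < G.dist (mobileEdge φ z).vertex := by
  have hmem : M.ReachesAt p y z (M.firstReach p y z) := Nat.sInf_mem hreach
  have hmin : ∀ k < M.firstReach p y z, ¬ M.ReachesAt p y z k :=
    fun k hk => Nat.notMem_of_lt_sInf hk
  unfold MobileGraph.IsInterrupted MobileGraph.whiteDist MobileGraph.blackDist
  generalize M.firstReach p y z = n at *
  simp only [reachesAt_iff hy hp] at hmem hmin
  -- It matters that `z` is first met at a white corner: there the arrival label is the distance of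
  -- its vertex, whereas at a black end it would exceed this by `b + 1`.
  obtain ⟨f, hf⟩ := exists_advance_tour_eq_inl_of_isEnd e.2
    (fun h => hz ((mobileEdge φ).injective (h.trans hy.symm))) hmem hmin
  have h := arriveDist_advance_tour_sub_cornerColour φ e.1 n
  rw [hf] at hmem h
  have hv := (MobileEdge.isEnd_inl_iff.mp hmem).1
  have hlz : M.label z = G.edgeColour f := by rw [label_eq_colour φ, hv]; rfl
  have hly : M.label y = G.edgeColour e.1 := by rw [label_eq_colour φ, hy]; rfl
  simp only [path_eq hy hp, hlz, hly, hv, Fin.lt_def]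
  simp only [arriveDist, cornerColour, Sum.elim_inl, Finset.sum_sub_distrib, ← Nat.cast_sum] at h
  generalize ∑ k ∈ Finset.range (n + 1), M.blackArc (spot φ (G.tour e.1 k)) = B at *
  generalize ∑ k ∈ Finset.range (n + 1), M.whiteArc (spot φ (G.tour e.1 k)) = W at *
  exact lt_or_eq_and_lt_iff (Fin.isLt _) (Fin.isLt _) h

end Simple

/-! ### The next edge and bubbles -/

variable {g d : ℕ} {μ : Composition d} {G : MarkedHurwitzGalaxy.{v} g μ (Composition.ones d)}

/-- The other incoming edge is either non-geodesic, giving an edge of positive weight, or geodesic,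
making the vertex double. -/
theorem exists_isEnd_inl_rot {e : G.Edge} (he : G.IsGeodesic e) (h : G.rot e ≠ e) :
    ∃ z : G.MobileEdge, z.IsEnd (.inl (G.rot e)) := by
  rw [exists_isEnd_inl_iff, target_rot, isDouble_target_iff]
  tauto

theorem tour_branchNumber_add {e : G.Edge} (he : ¬ G.IsGeodesic e) {i j : ℕ}
    (hfix : ∀ k, i < k → k ≤ branchNumber g μ (Composition.ones d) →
      G.rot ((G.black ^ k) e) = (G.black ^ k) e)
    (hij : i + j ≤ branchNumber g μ (Composition.ones d)) :
    G.tour e (branchNumber g μ (Composition.ones d) + 1 + j) =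
      .inl (G.black ((G.black ^ (branchNumber g μ (Composition.ones d) - j)) e)) := by
  induction j with
  | zero =>
    rw [← Perm.mul_apply, ← pow_succ', Nat.sub_zero, G.black_pow_branchNumber]
    exact tour_branchNumber_add_one he
  | succ j ih =>
    have h1 := hfix (branchNumber g μ (Composition.ones d) - j) (by omega) (by omega)
    rw [← add_assoc, tour_succ, ih (by omega), advance, G.white_inv_black, h1, cross,
      if_pos (isGeodesic_black_pow he (by omega) (by omega)),
      if_neg fun h => (G.isDouble_target_iff.mp h).1 h1, ← Perm.mul_apply, ← pow_succ']
    congr 4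
    omega

theorem advance_tour_branchNumber_add {e : G.Edge} (he : ¬ G.IsGeodesic e) {i j : ℕ}
    (hfix : ∀ k, i < k → k ≤ branchNumber g μ (Composition.ones d) →
      G.rot ((G.black ^ k) e) = (G.black ^ k) e)
    (hij : i + j ≤ branchNumber g μ (Composition.ones d)) :
    G.advance (G.tour e (branchNumber g μ (Composition.ones d) + 1 + j)) =
      .inl (G.rot ((G.black ^ (branchNumber g μ (Composition.ones d) - j)) e)) := by
  rw [tour_branchNumber_add he hfix hij, advance, G.white_inv_black]

/-- On the way back, step `b + 1 + j` reaches the endpoint of `black ^ (b - j) e`. The bound on `k`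
keeps this exponent above `i`, where all vertices are 2-valent. -/
theorem eq_of_isEnd_advance_tour (e : {e // ¬ G.IsGeodesic e}) {i k : ℕ}
    (hfix : ∀ k, i < k → k ≤ branchNumber g μ (Composition.ones d) →
      G.rot ((G.black ^ k) e.1) = (G.black ^ k) e.1)
    (hk : k + i ≤ 2 * branchNumber g μ (Composition.ones d)) {z : G.MobileEdge}
    (hz : z.IsEnd (G.advance (G.tour e.1 k))) : z = .inl e := by
  rcases lt_trichotomy k (branchNumber g μ (Composition.ones d)) with h | rfl | h
  · rw [tour_eq_inr e.2 h.le, advance, ← Perm.mul_apply, ← pow_succ'] at hz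
    exact absurd (isGeodesic_black_pow e.2 (by omega) h) (MobileEdge.isEnd_inr_iff.mp hz).1
  · rw [advance_tour_branchNumber e.2] at hz
    exact (MobileEdge.isEnd_inr_iff.mp hz).2
  · obtain ⟨j, rfl⟩ := Nat.exists_eq_add_of_lt h
    have h1 := hfix (branchNumber g μ (Composition.ones d) - j) (by omega) (by omega)
    have h2 : branchNumber g μ (Composition.ones d) + j + 1 =
      branchNumber g μ (Composition.ones d) + 1 + j := by omega
    rw [h2, advance_tour_branchNumber_add e.2 hfix (by omega), h1] at hz
    rcases exists_isEnd_inl_iff.mp ⟨z, hz⟩ with h3 | h3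
    · exact absurd (isGeodesic_black_pow e.2 (by omega) (by omega)) h3
    · exact absurd h1 (G.isDouble_target_iff.mp h3).1

/-- The edge `z` of the mobile comes next after `e` on the tour around the mobile. -/
def IsNext (e : {e // ¬ G.IsGeodesic e}) (z : G.MobileEdge) : Prop :=
  z ≠ .inl e ∧ ∃ k, z.IsEnd (G.advance (G.tour e.1 k)) ∧
    ∀ i < k, ∀ w : G.MobileEdge, w.IsEnd (G.advance (G.tour e.1 i)) → w = .inl e

theorem IsNext.unique {e : {e // ¬ G.IsGeodesic e}} {z w : G.MobileEdge} (hz : IsNext e z)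
    (hw : IsNext e w) : z = w := by
  obtain ⟨hz, k, hk, hk'⟩ := hz
  obtain ⟨hw, l, hl, hl'⟩ := hw
  rcases lt_trichotomy k l with h | rfl | h
  · exact absurd (hl' k h z hk) hz
  · exact MobileEdge.eq_of_isEnd hk hl
  · exact absurd (hk' l h w hl) hw

/-- The next edge is found at the last 4-valent vertex of the black face. -/
theorem isNext_of_isEnd_rot (e : {e // ¬ G.IsGeodesic e}) {i : ℕ} (h0 : 1 ≤ i)
    (hi : i ≤ branchNumber g μ (Composition.ones d))
    (hfix : ∀ k, i < k → k ≤ branchNumber g μ (Composition.ones d) →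
      G.rot ((G.black ^ k) e.1) = (G.black ^ k) e.1)
    {z : G.MobileEdge} (hz : z.IsEnd (.inl (G.rot ((G.black ^ i) e.1)))) : IsNext e z := by
  refine ⟨?_, branchNumber g μ (Composition.ones d) + 1 +
    (branchNumber g μ (Composition.ones d) - i), ?_, fun k hk w hw => ?_⟩
  · rintro rfl
    have h1 := (MobileEdge.isEnd_inl_iff.mp hz).1
    rw [target_rot] at h1
    have h2 := dist_black_pow e.2 hi
    rw [← h1, MobileEdge.vertex] at h2
    omega
  · rw [advance_tour_branchNumber_add e.2 hfix (by omega), Nat.sub_sub_self hi]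
    exact hz
  · exact eq_of_isEnd_advance_tour e hfix (by omega) hw

theorem dist_vertex_of_isEnd_rot {e : G.Edge} (he : ¬ G.IsGeodesic e) {i : ℕ}
    (hi : i ≤ branchNumber g μ (Composition.ones d)) {z : G.MobileEdge}
    (hz : z.IsEnd (.inl (G.rot ((G.black ^ i) e)))) :
    G.dist z.vertex = G.dist (G.target e) + i := by
  rw [(MobileEdge.isEnd_inl_iff.mp hz).1, target_rot, dist_black_pow he hi]

/-- In a bubble the way back ends at the corner of `rot e`, where no mobile edge ends: `rot e` is
geodesic and `e` is not. The tour goes on backwards along a white boundary, and as long as it meets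
no mobile edge it passes geodesic edges, each lowering the distance by one. -/
theorem dist_lt_of_isNext {e : {e // ¬ G.IsGeodesic e}} (he : G.edgeColour e.1 ≠ 0)
    (hfix : ∀ k, 0 < k → k ≤ branchNumber g μ (Composition.ones d) →
      G.rot ((G.black ^ k) e.1) = (G.black ^ k) e.1)
    {z : G.MobileEdge} (hz : IsNext e z) : G.dist z.vertex < G.dist (G.target e.1) := by
  obtain ⟨hne, k, hk, hk'⟩ := hz
  have hrot := G.isGeodesic_rot e.2 he
  have hend : ¬ ∃ w : G.MobileEdge, w.IsEnd (.inl (G.rot e.1)) := by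
    rw [exists_isEnd_inl_iff, isDouble_target_iff, G.rot_rot]
    have := e.2
    tauto
  have hadv := advance_tour_branchNumber_add e.2 hfix
    (j := branchNumber g μ (Composition.ones d)) (by omega)
  rw [Nat.sub_self, pow_zero, Perm.one_apply] at hadv
  have key : ∀ j, 2 * branchNumber g μ (Composition.ones d) + 2 + j ≤ k → ∃ f,
      G.tour e.1 (2 * branchNumber g μ (Composition.ones d) + 2 + j) = .inl f ∧
        G.dist (G.source f) + 1 + j = G.dist (G.target e.1) := by
    intro j
    induction j with
    | zero =>
      intro _
      refine ⟨G.rot e.1, ?_, ?_⟩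
      · have : 2 * branchNumber g μ (Composition.ones d) + 2 + 0 =
          branchNumber g μ (Composition.ones d) + 1 +
            branchNumber g μ (Composition.ones d) + 1 := by omega
        rw [this, tour_succ, hadv, cross_of_forall_not_isEnd fun w hw => hend ⟨w, hw⟩]
      · rw [add_zero, ← (G.isGeodesic_iff _).mp hrot, target_rot]
    | succ j ih =>
      intro hj
      obtain ⟨f, hf, hdist⟩ := ih (by omega)
      -- Before the next edge only `e` itself could be met, but the vertex reached is already
      -- strictly closer to the root than the endpoint of `e`.
      have hnot : ∀ w : G.MobileEdge, ¬ w.IsEnd (.inl (G.white⁻¹ f)) := by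
        intro w hw
        have h1 := hk' (2 * branchNumber g μ (Composition.ones d) + 2 + j) (by omega) w
          (by rwa [hf, advance])
        have h2 := (MobileEdge.isEnd_inl_iff.mp hw).1
        rw [h1, MobileEdge.vertex] at h2
        change G.target e.1 = G.source f at h2
        rw [h2] at hdist
        omega
      refine ⟨G.white⁻¹ f, ?_, ?_⟩
      · rw [← add_assoc, tour_succ, hf, advance, cross_of_forall_not_isEnd hnot]
      · have h1 : ¬ ∃ w : G.MobileEdge, w.IsEnd (.inl (G.white⁻¹ f)) := fun ⟨w, hw⟩ => hnot w hw
        rw [exists_isEnd_inl_iff, not_or, not_not] at h1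
        have h2 := (G.isGeodesic_iff _).mp h1.1
        change G.dist (G.source f) = _ at h2
        omega
  have hge : 2 * branchNumber g μ (Composition.ones d) + 2 ≤ k := by
    by_contra! hlt
    rcases Nat.lt_succ_iff_lt_or_eq.mp hlt with hlt | rfl
    · exact hne (eq_of_isEnd_advance_tour e hfix (by omega) hk)
    · refine hend ⟨z, ?_⟩
      rw [← hadv]
      convert hk using 3
      omega
  obtain ⟨f, hf, hdist⟩ := key (k - (2 * branchNumber g μ (Composition.ones d) + 2)) (by omega)
  rw [Nat.add_sub_cancel' hge] at hf
  rw [hf, advance] at hk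
  have h1 : z.vertex = G.source f := (MobileEdge.isEnd_inl_iff.mp hk).1
  rw [h1]
  omega

theorem isBlackBubble_iff_of_edgeColour_ne_zero {e : G.Edge} (he : ¬ G.IsGeodesic e)
    (h : G.edgeColour e ≠ 0) : G.IsBlackBubble (G.blackFace e) ↔
      ∀ k, 0 < k → k ≤ branchNumber g μ (Composition.ones d) →
        G.rot ((G.black ^ k) e) = (G.black ^ k) e := by
  have hrot := G.rot_ne_of_not_isGeodesic he h
  rw [G.isBlackBubble_iff]
  constructor
  · intro hu k h0 hk
    by_contra h1
    have h2 := hu.unique ⟨G.blackFace_black_pow k e, h1⟩ ⟨rfl, hrot⟩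
    have := G.black_pow_injOn (j := 0) hk (by omega) h2
    omega
  · refine fun hfix => ⟨e, ⟨rfl, hrot⟩, ?_⟩
    rintro f ⟨hf, hf'⟩
    obtain ⟨i, hi, rfl⟩ := G.exists_black_pow_eq hf
    rcases Nat.eq_zero_or_pos i with rfl | h0
    · simp
    · exact absurd (hfix i h0 hi) hf'

theorem exists_last_rot_ne {e : G.Edge} {i : ℕ} (hi : i ≤ branchNumber g μ (Composition.ones d))
    (h : G.rot ((G.black ^ i) e) ≠ (G.black ^ i) e) :
    ∃ j, i ≤ j ∧ j ≤ branchNumber g μ (Composition.ones d) ∧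
      G.rot ((G.black ^ j) e) ≠ (G.black ^ j) e ∧
      ∀ k, j < k → k ≤ branchNumber g μ (Composition.ones d) →
        G.rot ((G.black ^ k) e) = (G.black ^ k) e := by
  classical
  refine ⟨Nat.findGreatest (fun j => G.rot ((G.black ^ j) e) ≠ (G.black ^ j) e)
    (branchNumber g μ (Composition.ones d)), Nat.le_findGreatest hi h, Nat.findGreatest_le _,
    Nat.findGreatest_spec (P := fun j => G.rot ((G.black ^ j) e) ≠ (G.black ^ j) e) hi h,
    fun k hk hk' => ?_⟩
  exact not_not.mp (Nat.findGreatest_is_greatest hk hk')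

theorem not_isBlackBubble_iff_of_edgeColour_ne_zero (e : {e // ¬ G.IsGeodesic e})
    (h : G.edgeColour e.1 ≠ 0) : ¬ G.IsBlackBubble (G.blackFace e.1) ↔
      ∃ z, IsNext e z ∧ G.dist (G.target e.1) < G.dist z.vertex := by
  rw [isBlackBubble_iff_of_edgeColour_ne_zero e.2 h]
  constructor
  · intro hfix
    push Not at hfix
    obtain ⟨i, h0, hi, hrot⟩ := hfix
    obtain ⟨j, hij, hj, hrot, hfix⟩ := exists_last_rot_ne hi hrot
    obtain ⟨z, hz⟩ := exists_isEnd_inl_rot (isGeodesic_black_pow e.2 (by omega) hj) hrot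
    refine ⟨z, isNext_of_isEnd_rot e (by omega) hj hfix hz, ?_⟩
    rw [dist_vertex_of_isEnd_rot e.2 hj hz]
    omega
  · rintro ⟨z, hz, hlt⟩ hfix
    exact hlt.not_gt (dist_lt_of_isNext h hfix hz)

/-- If the black face at the root has only one 4-valent vertex, then every path that leaves this
face passes through that vertex. -/
theorem exists_eq_target_or_lt_of_orientedPath {e : G.Edge} (he : ¬ G.IsGeodesic e)
    (hroot : G.target e = G.root) {i : ℕ}
    (hfix : ∀ k, k ≠ i → k ≤ branchNumber g μ (Composition.ones d) →
      G.rot ((G.black ^ k) e) = (G.black ^ k) e)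
    {n : ℕ} {x : G.Vertex} (h : G.OrientedPath n G.root x) :
    (∃ k ≤ branchNumber g μ (Composition.ones d), x = G.target ((G.black ^ k) e)) ∨ i < n := by
  generalize hr : G.root = r at h
  induction h with
  | nil => exact .inl ⟨0, by omega, by rw [← hr, ← hroot]; simp⟩
  | snoc f hp ih =>
    rcases ih hr with ⟨k, hk, hsource⟩ | hlt
    · by_cases hki : k = i
      · subst hki
        refine .inr (Nat.lt_succ_of_le ?_)
        subst hr
        have h1 := dist_le hp
        rw [hsource, dist_black_pow he hk, hroot, dist_root] at h1
        omega
      · have hf : f = (G.black ^ (k + 1)) e := by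
          rw [pow_succ', Perm.mul_apply]
          rcases G.eq_black_or_white_of_source_eq hsource with h1 | h1
          · exact h1
          · rw [h1, rot_eq_self_iff.mp (hfix k hki hk)]
        obtain ⟨l, hl, hl'⟩ := G.exists_black_pow_eq (G.blackFace_black_pow (k + 1) e)
        exact .inl ⟨l, hl, by rw [hf, hl']⟩
    · exact .inr (by omega)

theorem not_isBlackBubble_iff_of_edgeColour_eq_zero (hd : 2 ≤ d) (e : {e // ¬ G.IsGeodesic e})
    (h : G.edgeColour e.1 = 0) : ¬ G.IsBlackBubble (G.blackFace e.1) ↔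
      (∃ x, IsNext e (.inr x)) ∨ ∃ f : {e // ¬ G.IsGeodesic e}, IsNext e (.inl f) ∧
        ∃ z : G.MobileEdge, z ≠ .inl f ∧ G.colour z.vertex ≠ 0 ∧
          ¬ G.dist (G.target f.1) < G.dist z.vertex := by
  have hroot := G.eq_root_of_edgeColour_eq_zero e.2 h
  have hdist : ∀ k ≤ branchNumber g μ (Composition.ones d),
      G.dist (G.target ((G.black ^ k) e.1)) = k := fun k hk => by
    rw [dist_black_pow e.2 hk, hroot, dist_root, zero_add]
  have hpos : ∀ k, G.rot ((G.black ^ k) e.1) ≠ (G.black ^ k) e.1 → 1 ≤ k := by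
    intro k hk
    by_contra h0
    obtain rfl : k = 0 := by omega
    exact hk (G.rot_eq_self_of_edgeColour_eq_zero h)
  obtain ⟨f, hf, hfrot⟩ := G.exists_rot_ne hd (G.blackFace e.1)
  obtain ⟨l, hl, rfl⟩ := G.exists_black_pow_eq hf
  obtain ⟨i, -, hi, hrot, hlast⟩ := exists_last_rot_ne hl hfrot
  clear hf hfrot hl
  have hi0 := hpos i hrot
  have hgeo := isGeodesic_black_pow e.2 hi0 hi
  obtain ⟨z, hz⟩ := exists_isEnd_inl_rot hgeo hrot
  have hnext := isNext_of_isEnd_rot e hi0 hi hlast hz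
  rw [G.isBlackBubble_iff]
  constructor
  · intro hnb
    obtain ⟨j, hj, hji, hjrot⟩ : ∃ j ≤ branchNumber g μ (Composition.ones d), j ≠ i ∧
        G.rot ((G.black ^ j) e.1) ≠ (G.black ^ j) e.1 := by
      by_contra! hall
      refine hnb ⟨_, ⟨G.blackFace_black_pow i e.1, hrot⟩, ?_⟩
      rintro f ⟨hf, hf'⟩
      obtain ⟨k, hk, rfl⟩ := G.exists_black_pow_eq hf
      by_cases hki : k = i
      · rw [hki]
      · exact absurd (hall k hk hki) hf'
    have hlt : j < i := lt_of_le_of_ne (not_lt.mp fun h1 => hjrot (hlast j h1 hj)) hji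
    have hj0 := hpos j hjrot
    rcases z with f | x
    · refine .inr ⟨f, hnext, ?_⟩
      -- The witness is the mobile edge at the earlier 4-valent vertex, at distance `j < i`.
      obtain ⟨w, hw⟩ := exists_isEnd_inl_rot (isGeodesic_black_pow e.2 hj0 hj) hjrot
      have hwv := (MobileEdge.isEnd_inl_iff.mp hw).1
      have hzv := (MobileEdge.isEnd_inl_iff.mp hz).1
      rw [target_rot] at hwv hzv
      have hzd : G.dist (G.target f.1) = i := by
        rw [← hdist i hi, ← hzv, MobileEdge.vertex]
      refine ⟨w, ?_, ?_, ?_⟩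
      · rintro rfl
        rw [MobileEdge.vertex] at hwv
        rw [hwv, hdist j hj] at hzd
        exact hji hzd
      · rw [hwv]
        change G.edgeColour _ ≠ 0
        rw [G.edgeColour_black_pow, h, zero_add]
        intro h1
        have h2 := congrArg Fin.val h1
        simp only [Fin.ofNat_eq_cast, Fin.val_natCast, Fin.val_zero] at h2
        rw [Nat.mod_eq_of_lt (by omega)] at h2
        omega
      · rw [hwv, hdist j hj, hzd]
        omega
    · exact .inl ⟨x, hnext⟩
  · intro hcond hb
    have hfix : ∀ k, k ≠ i → k ≤ branchNumber g μ (Composition.ones d) →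
        G.rot ((G.black ^ k) e.1) = (G.black ^ k) e.1 := by
      intro k hki hk
      by_contra h1
      exact hki (G.black_pow_injOn hk hi
        (hb.unique ⟨G.blackFace_black_pow k e.1, h1⟩ ⟨G.blackFace_black_pow i e.1, hrot⟩))
    have hpath := fun x => exists_eq_target_or_lt_of_orientedPath e.2 hroot hfix
      (G.orientedPath_dist x)
    -- If this edge were geodesic, its source would have distance `i - 1`, too small to lie outside
    -- the face. The edge would then be the boundary edge `black ^ i e` itself.
    have hrotgeo : ¬ G.IsGeodesic (G.rot ((G.black ^ i) e.1)) := by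
      intro h1
      have h2 := (G.isGeodesic_iff _).mp h1
      rw [target_rot, hdist i hi] at h2
      rcases hpath (G.source (G.rot ((G.black ^ i) e.1))) with ⟨k, hk, hk'⟩ | h3
      · have h4 : k + 1 = i := by rw [h2, hk', hdist k hk]
        apply hrot
        have h5 : (G.black ^ i) e.1 = G.black ((G.black ^ k) e.1) := by
          rw [← h4, pow_succ', Perm.mul_apply]
        rcases G.eq_black_or_white_of_source_eq hk' with h6 | h6
        · rw [h6, h5]
        · rw [h6, h5, rot_eq_self_iff.mp (hfix k (by omega) hk)]
      · omega
    have hzeq : z = .inl ⟨_, hrotgeo⟩ := MobileEdge.eq_of_isEnd hz (.inl rfl)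
    rcases hcond with ⟨x, hx⟩ | ⟨f, hf, w, hwf, hw0, hw⟩
    · have := hx.unique hnext
      rw [hzeq] at this
      exact Sum.inr_ne_inl this
    · have hfz := hf.unique hnext
      rw [hzeq] at hfz
      rw [hfz] at hwf
      obtain rfl := Sum.inl_injective hfz
      simp only [target_rot, hdist i hi] at hw
      -- If `w` lies on the face, it sits at the only 4-valent vertex, whose only mobile edge is
      -- `f`; outside the face distances exceed `i`.
      rcases hpath w.vertex with ⟨k, hk, hk'⟩ | h3
      · rcases w with q | x
        · have hq := G.rot_ne_of_not_isGeodesic q.2 hw0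
          rcases G.target_eq_target_iff.mp hk' with h4 | h4
          · by_cases hki : k = i
            · exact q.2 (by rwa [h4, hki])
            · exact hq (by rw [h4, hfix k hki hk])
          · by_cases hki : k = i
            · exact hwf (congrArg Sum.inl (Subtype.ext (by rw [h4, hki])))
            · exact hq (by rw [h4, hfix k hki hk, hfix k hki hk])
        · have hx := x.2
          have hx' : x.1 = _ := hk'
          rw [hx', isDouble_target_iff] at hx
          by_cases hki : k = i
          · rw [hki] at hx
            exact hrotgeo hx.2.2
          · exact hx.1 (hfix k hki hk)
      · exact hw h3

/-! ### The two conditions in terms of the galaxy -/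

section General

variable {g d : ℕ} {μ : Composition d} {G : MarkedHurwitzGalaxy.{v} g μ (Composition.ones d)}
  {M : MobileGraph.{u} (branchNumber g μ (Composition.ones d)) μ.length
    (Composition.ones d).length} {φ : M.Iso G.mobile}

theorem isNextEdge_iff {p : M.BlackNode} {y z : M.Edge} {e : {e // ¬ G.IsGeodesic e}}
    (hy : mobileEdge φ y = .inl e) (hp : M.Inc y (.inr p)) :
    M.IsNextEdge p y z ↔ IsNext e (mobileEdge φ z) := by
  simp only [MobileGraph.IsNextEdge, IsNext, reachesAt_iff hy hp, ← hy, ne_eq,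
    (mobileEdge φ).surjective.forall, (mobileEdge φ).apply_eq_iff_eq]

theorem nonzeroCondition_iff (φ : M.Iso G.mobile) (e : {e // ¬ G.IsGeodesic e}) :
    M.NonzeroCondition (G.blackFace e.1) ↔ G.edgeColour e.1 ≠ 0 ∧
      ∃ z, IsNext e z ∧ G.dist (G.target e.1) < G.dist z.vertex := by
  have key : ∀ {p y z}, mobileEdge φ y = .inl e → M.Inc y (.inr p) →
      (M.IsNextEdge p y z ∧ M.IsInterrupted p y z ↔ IsNext e (mobileEdge φ z) ∧
        G.dist (G.target e.1) < G.dist (mobileEdge φ z).vertex) := by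
    intro p y z hy hp
    rw [← isNextEdge_iff hy hp]
    refine and_congr_right fun hz => ?_
    obtain ⟨hne, k, hk, -⟩ := hz
    exact isInterrupted_iff hy hp hne ⟨k, hk⟩
  have hlabel : ∀ {y}, mobileEdge φ y = .inl e → M.label y = G.edgeColour e.1 := by
    intro y hy
    rw [label_eq_colour φ, hy]
    rfl
  constructor
  · rintro ⟨p, y, hone, h0, z, hz⟩
    obtain ⟨hp, e', hy, he⟩ := (isWeightOneEdge_iff (φ := φ)).mp hone
    obtain rfl : e' = e := Subtype.ext (eq_of_not_isGeodesic e'.2 e.2 he)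
    exact ⟨hlabel hy ▸ h0, _, (key hy hp).mp hz⟩
  · rintro ⟨h0, z, hz⟩
    obtain ⟨z, rfl⟩ := (mobileEdge φ).surjective z
    obtain ⟨p, y, hy, hp⟩ := exists_isWeightOneEdge (φ := φ) e
    exact ⟨p, y, (isWeightOneEdge_iff (φ := φ)).mpr ⟨hp, e, hy, rfl⟩, hlabel hy ▸ h0, z,
      (key hy hp).mpr hz⟩

theorem weight_eq_zero_iff (φ : M.Iso G.mobile) (y : M.Edge) :
    M.weight y = 0 ↔ ∃ x, mobileEdge φ y = .inr x := by
  have h : M.weight y = G.mobile.weight (mobileEdge φ y) := (φ.weight y).symm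
  rw [h]
  rcases mobileEdge φ y with e | x
  · simp only [reduceCtorEq, exists_false, iff_false]
    exact e.2
  · simp only [Sum.inr.injEq, exists_eq', iff_true]
    rfl

end General

variable {d : ℕ} {μ : Composition d} {G : MarkedHurwitzGalaxy.{v} 0 μ (Composition.ones d)}

/-- Unlike a next edge, the edge `z` of alternative (b) is not reached by definition. Its
interruption can be read off from distances only because the tour visits every mobile edge. -/
theorem zeroCondition_iff (hd : 2 ≤ d) (M : HurwitzMobile.{u} μ (Composition.ones d))
    (φ : M.toMobileGraph.Iso G.mobile) (e : {e // ¬ G.IsGeodesic e}) :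
    M.ZeroCondition (G.blackFace e.1) ↔ G.edgeColour e.1 = 0 ∧
      ((∃ x, IsNext e (.inr x)) ∨ ∃ f : {e // ¬ G.IsGeodesic e}, IsNext e (.inl f) ∧
        ∃ z : G.MobileEdge, z ≠ .inl f ∧ G.colour z.vertex ≠ 0 ∧
          ¬ G.dist (G.target f.1) < G.dist z.vertex) := by
  have hlabel : ∀ {y}, mobileEdge φ y = .inl e → M.label y = G.edgeColour e.1 := by
    intro y hy
    rw [label_eq_colour φ, hy]
    rfl
  have key : ∀ {q y z} {f : {e // ¬ G.IsGeodesic e}}, mobileEdge φ y = .inl f →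
      M.Inc y (.inr q) → z ≠ y → (M.IsInterrupted q y z ↔
        G.dist (G.target f.1) < G.dist (mobileEdge φ z).vertex) := by
    intro q y z f hy hq hz
    refine isInterrupted_iff hy hq hz ?_
    simp only [reachesAt_iff hy hq]
    exact exists_isEnd_advance_tour hd M φ f.2 _
  constructor
  · rintro ⟨p, y, hone, h0, h⟩
    obtain ⟨hp, e', hy, he⟩ := (isWeightOneEdge_iff (φ := φ)).mp hone
    obtain rfl : e' = e := Subtype.ext (eq_of_not_isGeodesic e'.2 e.2 he)
    refine ⟨hlabel hy ▸ h0, ?_⟩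
    rcases h with ⟨w, hw, hw0⟩ | ⟨w, hw, Q, q, hQ, z, hz, hz0, hint⟩
    · obtain ⟨x, hx⟩ := (weight_eq_zero_iff φ w).mp hw0
      exact .inl ⟨x, hx ▸ (isNextEdge_iff hy hp).mp hw⟩
    · obtain ⟨hq, f, hf, -⟩ := (isWeightOneEdge_iff (φ := φ)).mp hQ
      refine .inr ⟨f, hf ▸ (isNextEdge_iff hy hp).mp hw, mobileEdge φ z, ?_, ?_, ?_⟩
      · rwa [← hf, (mobileEdge φ).apply_eq_iff_eq.ne]
      · rwa [← label_eq_colour φ]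
      · rwa [← key hf hq hz]
  · rintro ⟨h0, h⟩
    obtain ⟨p, y, hy, hp⟩ := exists_isWeightOneEdge (φ := φ) e
    refine ⟨p, y, (isWeightOneEdge_iff (φ := φ)).mpr ⟨hp, e, hy, rfl⟩, hlabel hy ▸ h0, ?_⟩
    rcases h with ⟨x, hx⟩ | ⟨f, hf, z, hz, hz0, hint⟩
    · obtain ⟨w, hw⟩ := (mobileEdge φ).surjective (.inr x)
      exact .inl ⟨w, (isNextEdge_iff hy hp).mpr (hw ▸ hx), (weight_eq_zero_iff φ w).mpr ⟨x, hw⟩⟩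
    · obtain ⟨q, w, hw, hq⟩ := exists_isWeightOneEdge (φ := φ) f
      obtain ⟨z, rfl⟩ := (mobileEdge φ).surjective z
      have hzw : z ≠ w := fun h => hz (by rw [h, hw])
      exact .inr ⟨w, (isNextEdge_iff hy hp).mpr (hw ▸ hf), _, q,
        (isWeightOneEdge_iff (φ := φ)).mpr ⟨hq, f, hw, rfl⟩, z, hzw,
        by rwa [label_eq_colour φ], by rwa [key hw hq hzw]⟩

end MarkedHurwitzGalaxy

theorem theorem4 {d : ℕ} (hd : 2 ≤ d) (μ : Composition d)
    (M : HurwitzMobile.{u} μ (Composition.ones d))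
    (G : MarkedHurwitzGalaxy.{v} 0 μ (Composition.ones d)) (hMG : M.IsMobileOf G) :
    G.IsPruned ↔
      ∀ P : Fin (Composition.ones d).length, M.NonzeroCondition P ∨ M.ZeroCondition P := by
  obtain ⟨φ⟩ := hMG
  refine forall_congr' fun P => ?_
  obtain ⟨e, rfl, he⟩ := G.exists_not_isGeodesic P
  rw [MarkedHurwitzGalaxy.nonzeroCondition_iff φ ⟨e, he⟩,
    MarkedHurwitzGalaxy.zeroCondition_iff hd M φ ⟨e, he⟩]
  by_cases h : G.edgeColour e = 0
  · simp only [h, ne_eq, not_true_eq_false, false_and, true_and, false_or]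
    exact MarkedHurwitzGalaxy.not_isBlackBubble_iff_of_edgeColour_eq_zero hd ⟨e, he⟩ h
  · simp only [h, ne_eq, not_false_eq_true, false_and, true_and, or_false]
    exact MarkedHurwitzGalaxy.not_isBlackBubble_iff_of_edgeColour_ne_zero ⟨e, he⟩ h
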